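/- Let $N\ge 2$ be an integer, $s\in(0,1)$ and $a:=1-2s$. Write points of $\mathbb R^{N+1}$ as $X=(x,y)$ with $x\in\mathbb R^N$, $y\in\mathbb R$, and let $\mathbb S^N_+:=\{X\in\mathbb R^{N+1}: |X|=1,\ y>0\}$, with surface measure $\sigma$ and boundary $\mathbb S^{N-1}=\{|X|=1,\ y=0\}$. Let $H^{1;a}(\mathbb S^N_+)$ be the space of functions $u$ on $\mathbb S^N_+$ with weak tangential gradient $\nabla_T u$ such that $\int_{\mathbb S^N_+} y^a\,(u^2+|\nabla_T u|^2)\,d\sigma<\infty$, with its natural norm. For a (relatively) open set $\omega\subset\mathbb S^{N-1}$ define $$\lambda_1^s(\omega):=\inf\left\{\frac{\int_{\mathbb S^N_+}y^a|\nabla_T u|^2\,d\sigma}{\int_{\mathbb S^N_+}y^a u^2\,d\sigma}\ :\ u\in H^{1;a}(\mathbb S^N_+)\setminus\{0\},\ u\equiv 0\text{ on }\mathbb S^{N-1}\setminus\omega\right\},$$ where "$u\equiv0$ on $\mathbb S^{N-1}\setminus\omega$" is understood in the sense of $H^{1;a}(\mathbb S^N_+)$: $u$ is the limit in $H^{1;a}(\mathbb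 S^N_+)$ of functions that are smooth up to the boundary and vanish at every point of $\mathbb S^{N-1}\setminus\omega$. For $t\ge0$ let $$\gamma(t):=\sqrt{\Big(\frac{N-2s}{2}\Big)^2+t}-\frac{N-2s}{2},$$ and let $$\nu_{ACF}:=\inf\left\{\frac{\gamma(\lambda_1^s(\omega_1))+\gamma(\lambda_1^s(\omega_2))}{2}\ :\ \omega_1,\omega_2\subset\mathbb S^{N-1}\text{ open},\ \omega_1\cap\omega_2=\emptyset\right\}.$$ Then $$0<\nu_{ACF}\le s.$$ -/

import Mathlib

open MeasureTheory Filter Topology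
open scoped ContDiff

noncomputable section

namespace SegregationACF

/-- `ℝ^{N+1}`, whose points are written `X = (x, y)` with `y` the last coordinate. -/
abbrev Ambient (N : ℕ) : Type := EuclideanSpace ℝ (Fin (N + 1))

/-- The unit sphere `𝕊^N` of `ℝ^{N+1}`. -/
abbrev USphere (N : ℕ) : Type := Metric.sphere (0 : Ambient N) 1

/-- The coordinate `y` of `X = (x, y)`. -/
def height {N : ℕ} (X : Ambient N) : ℝ := X (Fin.last N)

/-- The open upper half-sphere `𝕊^N_+ = 𝕊^N ∩ {y > 0}`. -/
def upperHalf (N : ℕ) : Set (USphere N) := {X | 0 < height (X : Ambient N)}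

/-- The boundary `𝕊^{N-1}` of `𝕊^N_+`, that is `𝕊^N ∩ {y = 0}`. -/
def equator (N : ℕ) : Set (Ambient N) := {X | ‖X‖ = 1 ∧ height X = 0}

/-- The surface measure `dσ` on `𝕊^N_+`. -/
def surf (N : ℕ) : Measure (USphere N) :=
  (volume : Measure (Ambient N)).toSphere.restrict (upperHalf N)

/-- The weighted surface measure `y^a dσ` on `𝕊^N_+`, where `a = 1 - 2s`. -/
def weightedSurf (N : ℕ) (s : ℝ) : Measure (USphere N) :=
  (surf N).withDensity fun X => ENNReal.ofReal (height (X : Ambient N) ^ (1 - 2 * s))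

/-- The tangential gradient `∇_T w = ∇w - ⟨X, ∇w⟩ X` at a point `X` of the unit sphere. -/
def tangGrad {N : ℕ} (w : Ambient N → ℝ) (X : Ambient N) : Ambient N :=
  gradient w X - inner ℝ X (gradient w X) • X

/-- The tangential divergence `div Φ - ⟨X, DΦ(X) X⟩` at a point `X` of the unit sphere. -/
def tangDiv {N : ℕ} (Φ : Ambient N → Ambient N) (X : Ambient N) : ℝ :=
  LinearMap.trace ℝ (Ambient N) (fderiv ℝ Φ X : Ambient N →ₗ[ℝ] Ambient N)
    - inner ℝ X (fderiv ℝ Φ X X)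

/-- `G` is the weak tangential gradient of `u` on the open half-sphere `𝕊^N_+`: it is tangent to the
sphere, and `∫ u div_T Φ dσ = - ∫ ⟨G, Φ⟩ dσ` for all smooth tangent fields `Φ` with compact
support in the open half-sphere. -/
def HasWeakTangGrad {N : ℕ} (u : USphere N → ℝ) (G : USphere N → Ambient N) : Prop :=
  (∀ᵐ X : USphere N ∂(surf N), inner ℝ (X : Ambient N) (G X) = 0) ∧
  ∀ Φ : Ambient N → Ambient N, ContDiff ℝ ∞ Φ → HasCompactSupport Φ →
    tsupport Φ ⊆ {X | 0 < height X} →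
    (∀ X : USphere N, inner ℝ (X : Ambient N) (Φ X) = 0) →
    ∫ X, u X * tangDiv Φ X ∂(surf N) = - ∫ X, inner ℝ (G X) (Φ X) ∂(surf N)

/-- `u` belongs to the weighted Sobolev space `H^{1;a}(𝕊^N_+)`, `a = 1 - 2s`, and `G` is its
weak tangential gradient. -/
structure MemH1 {N : ℕ} (s : ℝ) (u : USphere N → ℝ) (G : USphere N → Ambient N) : Prop where
  memLp : MemLp u 2 (weightedSurf N s)
  memLp_grad : MemLp G 2 (weightedSurf N s)
  weakGrad : HasWeakTangGrad u G

/-- `u ≡ 0` on `𝕊^{N-1} \ Ω` in the sense of `H^{1;a}(𝕊^N_+)`: the function `u`, with weak tangential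
gradient `G`, is the limit in `H^{1;a}(𝕊^N_+)` of functions that are smooth up to the boundary and
vanish at every point of `𝕊^{N-1} \ Ω`. -/
def VanishesOff {N : ℕ} (s : ℝ) (Ω : Set (equator N)) (u : USphere N → ℝ)
    (G : USphere N → Ambient N) : Prop :=
  ∃ w : ℕ → Ambient N → ℝ,
    (∀ n, ContDiff ℝ ∞ (w n)) ∧
    (∀ n, ∀ X : equator N, X ∉ Ω → w n X = 0) ∧
    Tendsto (fun n => eLpNorm (fun X : USphere N => w n X - u X) 2 (weightedSurf N s))
      atTop (𝓝 0) ∧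
    Tendsto (fun n => eLpNorm (fun X : USphere N => tangGrad (w n) X - G X) 2 (weightedSurf N s))
      atTop (𝓝 0)

/-- The first `s`-eigenvalue `λ₁^s(Ω)`: the infimum of the Rayleigh quotient over the nonzero
`u ∈ H^{1;a}(𝕊^N_+)` with `u ≡ 0` on `𝕊^{N-1} \ Ω`. -/
def firstEigenvalue {N : ℕ} (s : ℝ) (Ω : Set (equator N)) : ℝ :=
  sInf {R : ℝ | ∃ (u : USphere N → ℝ) (G : USphere N → Ambient N),
    MemH1 s u G ∧ VanishesOff s Ω u G ∧
    ∫ X, u X ^ 2 ∂(weightedSurf N s) ≠ 0 ∧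
    R = (∫ X, ‖G X‖ ^ 2 ∂(weightedSurf N s)) / ∫ X, u X ^ 2 ∂(weightedSurf N s)}

/-- `γ(t) = √(((N - 2s)/2)² + t) - (N - 2s)/2`. -/
def growthRate (N : ℕ) (s t : ℝ) : ℝ :=
  Real.sqrt (((N - 2 * s) / 2) ^ 2 + t) - (N - 2 * s) / 2

/-- The optimal partition constant: the infimum of `(γ(λ₁^s(Ω₁)) + γ(λ₁^s(Ω₂))) / 2` over
pairs of disjoint relatively open subsets `Ω₁`, `Ω₂` of `𝕊^{N-1}`. -/
def nuACF (N : ℕ) (s : ℝ) : ℝ :=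
  sInf {r : ℝ | ∃ Ω₁ Ω₂ : Set (equator N), IsOpen Ω₁ ∧ IsOpen Ω₂ ∧ Ω₁ ∩ Ω₂ = ∅ ∧
    r = (growthRate N s (firstEigenvalue s Ω₁) + growthRate N s (firstEigenvalue s Ω₂)) / 2}

end SegregationACF

end

/-!
**Lower bound.** The heart of the matter is one inequality for a function `w` that is smooth up
to the boundary (`lintegral_trace_le`): with `μ = y^a dσ` on the half-sphere and `z` ranging
over the unit ball of `ℝ^N`,

  `∫ dz ∫ (w(X) - w(z/|z|))² dμ(X) ≤ C ∫ |∇_T w|² dμ`.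

It combines the Poincaré and the trace inequality. Let `W(P) = w(P/|P|)` be the extension of `w`
homogeneous of degree zero. In polar coordinates both sides become integrals over the upper half
of the unit ball, which is convex, so that `W(x, y) - W(z, 0)` can be estimated by integrating
`∇W` along the segment from `(z, 0)` to `(x, y)`. Cauchy–Schwarz with the weight `t^{1-s}` and a
linear change of variables at each time `t` (in `z` for `t ≤ 1/2`, in `x` for `t ≥ 1/2`, see
`lintegral_segment_le`) leave the integral `∫₀¹ t^{s-1} dt`, which converges. The extension has
finite energy near the origin because `N - 2 + a > -1`, which uses `N ≥ 2`.

If `w₁` and `w₂` vanish off disjoint subsets of the equator, then at each point `z/|z|` one of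
them is zero, and there the inner integral for this function is its full square norm. Hence the
sum of the Rayleigh quotients of `w₁` and `w₂` is at least a constant depending only on `N` and
`s` (`gapConst_le_add_rayleigh`); the bound passes to limits in `H^{1;a}` and to the infima, and
`γ` is increasing with `γ(0) = 0`.

**Upper bound.** The pair consisting of the whole equator and the empty set is admissible.
Constants show that the first eigenvalue of the whole equator is zero. For the empty set
`y^{2s}` is a competitor (approximated by `(y² + δ)^s - δ^s`), with Rayleigh quotient `2sN`,
computed from the recursion `(N + p + 1) ∫ y^{p+2} dσ = (p + 1) ∫ y^p dσ`, and `γ(2sN) = 2s`.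
That smooth functions belong to `H^{1;a}` with their classical tangential gradient is the
divergence theorem on the sphere (`integral_tangDiv_eq_zero`).
-/

noncomputable section

namespace SegregationACF

open Set
open scoped ENNReal

/-! ### Polar and Cartesian coordinates -/

/-- Integration in polar coordinates on `ℝ^{N+1}`. -/
theorem lintegral_polar {N : ℕ} {f : Ambient N → ℝ≥0∞} (hf : Measurable f) :
    ∫⁻ P, f P = ∫⁻ X : USphere N, (∫⁻ r in Ioi (0 : ℝ),
      ENNReal.ofReal (r ^ N) * f (r • (X : Ambient N))) ∂(volume : Measure (Ambient N)).toSphere := by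
  have hdim : Module.finrank ℝ (Ambient N) - 1 = N := by simp
  have hmp := (volume : Measure (Ambient N)).measurePreserving_homeomorphUnitSphereProd
  have hpt : Measurable fun q : USphere N × Ioi (0 : ℝ) => f ((q.2 : ℝ) • (q.1 : Ambient N)) := by
    fun_prop
  calc ∫⁻ P, f P = ∫⁻ P in ({0}ᶜ : Set (Ambient N)), f P := by rw [restrict_compl_singleton]
    _ = ∫⁻ P : ({0}ᶜ : Set (Ambient N)), f P ∂(Measure.comap Subtype.val volume) :=
        (lintegral_subtype_comap (measurableSet_singleton _).compl f).symm
    _ = ∫⁻ q, f ((q.2 : ℝ) • (q.1 : Ambient N)) ∂((volume : Measure (Ambient N)).toSphere.prod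
          (Measure.volumeIoiPow (Module.finrank ℝ (Ambient N) - 1))) := by
        rw [← hmp.lintegral_comp_emb (Homeomorph.measurableEmbedding _)]
        refine lintegral_congr fun P => ?_
        rw [← homeomorphUnitSphereProd_symm_apply_coe, Homeomorph.symm_apply_apply]
    _ = _ := by
        rw [lintegral_prod _ hpt.aemeasurable, hdim]
        refine lintegral_congr fun X => ?_
        have h1 : Measurable fun r : Ioi (0 : ℝ) => ENNReal.ofReal ((r : ℝ) ^ N) := by fun_prop
        have h2 : Measurable fun r : Ioi (0 : ℝ) => f ((r : ℝ) • (X : Ambient N)) := by fun_prop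
        rw [Measure.volumeIoiPow, lintegral_withDensity_eq_lintegral_mul _ h1 h2]
        exact lintegral_subtype_comap measurableSet_Ioi
          fun r : ℝ => ENNReal.ofReal (r ^ N) * f (r • (X : Ambient N))

/-- The point `(x, y)` of `ℝ^{N+1}` with horizontal part `x` and height `y`. -/
def point {N : ℕ} (x : Fin N → ℝ) (y : ℝ) : Ambient N :=
  WithLp.toLp 2 (Fin.snoc x y : Fin (N + 1) → ℝ)

@[simp] theorem height_point {N : ℕ} (x : Fin N → ℝ) (y : ℝ) : height (point x y) = y := by
  simp [height, point]

@[simp] theorem point_castSucc {N : ℕ} (x : Fin N → ℝ) (y : ℝ) (i : Fin N) :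
    point x y i.castSucc = x i := by
  simp [point]

@[simp] theorem point_last {N : ℕ} (x : Fin N → ℝ) (y : ℝ) : point x y (Fin.last N) = y := by
  simp [point]

theorem norm_sq_point {N : ℕ} (x : Fin N → ℝ) (y : ℝ) :
    ‖point x y‖ ^ 2 = ∑ i, x i ^ 2 + y ^ 2 := by
  rw [EuclideanSpace.norm_sq_eq, Fin.sum_univ_castSucc]
  simp

theorem point_add_smul {N : ℕ} (c t : ℝ) (z x : Fin N → ℝ) (v y : ℝ) :
    point (c • z + t • x) (c * v + t * y) = c • point z v + t • point x y := by
  ext i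
  refine Fin.lastCases ?_ (fun i => ?_) i <;> simp

theorem continuous_point {N : ℕ} : Continuous fun q : (Fin N → ℝ) × ℝ => point q.1 q.2 := by
  refine (PiLp.continuous_toLp 2 _).comp (continuous_pi fun i => ?_)
  refine Fin.lastCases ?_ (fun i => ?_) i
  · simpa using continuous_snd
  · simpa [Function.comp_def] using (continuous_apply i).comp continuous_fst

@[fun_prop] theorem measurable_point_comp {α : Type*} [MeasurableSpace α] {N : ℕ}
    {x : α → Fin N → ℝ} {y : α → ℝ} (hx : Measurable x) (hy : Measurable y) :
    Measurable fun q => SegregationACF.point (x q) (y q) :=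
  continuous_point.measurable.comp (hx.prodMk hy)

theorem continuous_height {N : ℕ} : Continuous (height : Ambient N → ℝ) := by
  unfold height; fun_prop

@[fun_prop] theorem measurable_height {N : ℕ} : Measurable (height : Ambient N → ℝ) :=
  continuous_height.measurable

theorem height_smul {N : ℕ} (r : ℝ) (X : Ambient N) : height (r • X) = r * height X := by
  simp [height]

/-- Lebesgue measure on `ℝ^{N+1}` is the product of the measures on `ℝ^N` and `ℝ`. -/
theorem lintegral_slice {N : ℕ} {f : Ambient N → ℝ≥0∞} (hf : Measurable f) :
    ∫⁻ P, f P = ∫⁻ x : Fin N → ℝ, ∫⁻ y : ℝ, f (point x y) := by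
  have e1 := PiLp.volume_preserving_toLp (Fin (N + 1))
  have e2 := (volume_preserving_piFinSuccAbove (fun _ : Fin (N + 1) => ℝ) (Fin.last N)).symm
  have hpt : ∀ q : ℝ × (Fin N → ℝ), WithLp.toLp 2
      ((MeasurableEquiv.piFinSuccAbove (fun _ : Fin (N + 1) => ℝ) (Fin.last N)).symm q)
        = point q.2 q.1 := by
    intro q
    rw [MeasurableEquiv.piFinSuccAbove_symm_apply]
    change WithLp.toLp 2 ((Fin.last N).insertNth (α := fun _ => ℝ) q.1 q.2) = _
    rw [Fin.insertNth_last]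
    rfl
  rw [← e1.lintegral_comp hf, ← e2.lintegral_comp
    (f := fun q => f (WithLp.toLp 2 q)) (hf.comp e1.measurable)]
  simp only [hpt]
  rw [Measure.volume_eq_prod, lintegral_prod_symm]
  exact (by fun_prop : Measurable fun q : ℝ × (Fin N → ℝ) => f (point q.2 q.1)).aemeasurable

/-! ### Moments of the surface measure on the half-sphere -/

/-- The Gaussian integral `∫₀^∞ r^p e^{-r²} dr`. -/
def gaussMoment (p : ℝ) : ℝ≥0∞ :=
  ∫⁻ r in Ioi (0 : ℝ), ENNReal.ofReal (r ^ p * Real.exp (-r ^ 2))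

theorem gaussMoment_eq {p : ℝ} (hp : -1 < p) :
    gaussMoment p = ENNReal.ofReal (1 / 2 * Real.Gamma ((p + 1) / 2)) := by
  have hint := integrableOn_rpow_mul_exp_neg_rpow (p := 2) hp two_pos
  have hval := integral_rpow_mul_exp_neg_rpow (p := 2) two_pos hp
  simp only [Real.rpow_two] at hint hval
  rw [gaussMoment, ← hval, ofReal_integral_eq_lintegral_ofReal hint]
  filter_upwards [ae_restrict_mem measurableSet_Ioi] with r hr
  have : 0 < r := hr
  positivity

theorem gaussMoment_ne_top {p : ℝ} (hp : -1 < p) : gaussMoment p ≠ ⊤ := by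
  rw [gaussMoment_eq hp]; exact ENNReal.ofReal_ne_top

theorem gaussMoment_ne_zero {p : ℝ} (hp : -1 < p) : gaussMoment p ≠ 0 := by
  have : 0 < Real.Gamma ((p + 1) / 2) := Real.Gamma_pos_of_pos (by linarith)
  simpa [gaussMoment_eq hp] using this

theorem gaussMoment_add_two {p : ℝ} (hp : -1 < p) :
    gaussMoment (p + 2) = ENNReal.ofReal ((p + 1) / 2) * gaussMoment p := by
  rw [gaussMoment_eq hp, gaussMoment_eq (by linarith), ← ENNReal.ofReal_mul (by linarith),
    show (p + 2 + 1) / 2 = (p + 1) / 2 + 1 by ring, Real.Gamma_add_one (by linarith)]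
  congr 1
  ring

theorem measurableSet_upperHalf (N : ℕ) : MeasurableSet (upperHalf N) :=
  measurableSet_lt measurable_const (by fun_prop)

instance (N : ℕ) : IsFiniteMeasure (surf N) := by
  unfold surf; infer_instance

/-- Polar coordinates in the upper half-space. -/
theorem lintegral_polar_upper {N : ℕ} {f : Ambient N → ℝ≥0∞} (hf : Measurable f)
    (h0 : ∀ P, height P ≤ 0 → f P = 0) :
    ∫⁻ P, f P = ∫⁻ X : USphere N, (∫⁻ r in Ioi (0 : ℝ),
      ENNReal.ofReal (r ^ N) * f (r • (X : Ambient N))) ∂(surf N) := by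
  rw [lintegral_polar hf, surf, ← lintegral_indicator (measurableSet_upperHalf N)]
  refine lintegral_congr fun X => ?_
  by_cases hX : X ∈ upperHalf N
  · rw [indicator_of_mem hX]
  · rw [indicator_of_notMem hX]
    refine (setLIntegral_congr_fun measurableSet_Ioi fun r hr => ?_).trans lintegral_zero
    rw [h0, mul_zero]
    rw [height_smul]
    exact mul_nonpos_of_nonneg_of_nonpos (le_of_lt hr) (not_lt.1 hX)

/-- Both sides are the integral of `y^p e^{-|X|²}` over the upper half-space, in Cartesian and in
polar coordinates. -/
theorem gaussian_mul_gaussMoment (N : ℕ) (p : ℝ) :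
    (∫⁻ x : Fin N → ℝ, ENNReal.ofReal (Real.exp (-∑ i, x i ^ 2))) * gaussMoment p =
      gaussMoment (N + p) * ∫⁻ X : USphere N, ENNReal.ofReal (height (X : Ambient N) ^ p)
        ∂(surf N) := by
  set f : Ambient N → ℝ≥0∞ := {P | 0 < height P}.indicator
    (fun P => ENNReal.ofReal (height P ^ p * Real.exp (-‖P‖ ^ 2))) with hf_def
  have hmeas : Measurable f :=
    Measurable.indicator (by fun_prop) (measurableSet_lt measurable_const measurable_height)
  have hcart := lintegral_slice hmeas
  have hpol := lintegral_polar_upper hmeas fun P hP =>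
    indicator_of_notMem (s := {P : Ambient N | 0 < height P}) (not_lt.2 hP) _
  have h1 : ∀ x : Fin N → ℝ, ∫⁻ y : ℝ, f (point x y) =
      ENNReal.ofReal (Real.exp (-∑ i, x i ^ 2)) * gaussMoment p := by
    intro x
    rw [gaussMoment, ← lintegral_const_mul _ (by fun_prop), ← lintegral_indicator measurableSet_Ioi]
    refine lintegral_congr fun y => ?_
    by_cases hy : 0 < y
    · rw [indicator_of_mem (mem_Ioi.2 hy), hf_def, indicator_of_mem (by simpa using hy),
        height_point, norm_sq_point, ← ENNReal.ofReal_mul (Real.exp_pos _).le, neg_add,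
        Real.exp_add]
      congr 1
      ring
    · rw [indicator_of_notMem (by simpa using hy), hf_def, indicator_of_notMem (by simpa using hy)]
  have h2 : ∀ᵐ X : USphere N ∂(surf N), ∫⁻ r in Ioi (0 : ℝ),
      ENNReal.ofReal (r ^ N) * f (r • (X : Ambient N)) =
        gaussMoment (N + p) * ENNReal.ofReal (height (X : Ambient N) ^ p) := by
    filter_upwards [ae_restrict_mem (measurableSet_upperHalf N)] with X hX
    have hX' : 0 < height (X : Ambient N) := hX
    rw [gaussMoment, ← lintegral_mul_const _ (by fun_prop)]
    refine setLIntegral_congr_fun measurableSet_Ioi fun r hr => ?_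
    have hr' : 0 < r := hr
    have hmem : r • (X : Ambient N) ∈ {P : Ambient N | 0 < height P} := by
      rw [mem_ofPred_eq, height_smul]; positivity
    rw [hf_def]
    beta_reduce
    rw [indicator_of_mem hmem, height_smul, norm_smul, norm_eq_of_mem_sphere, mul_one,
      Real.norm_of_nonneg hr'.le, ← ENNReal.ofReal_mul (by positivity),
      ← ENNReal.ofReal_mul (by positivity), Real.mul_rpow hr'.le hX'.le, Real.rpow_add hr',
      Real.rpow_natCast]
    congr 1
    ring
  rw [lintegral_congr h1, lintegral_mul_const _ (by fun_prop)] at hcart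
  rw [lintegral_congr_ae h2, lintegral_const_mul _ (by fun_prop)] at hpol
  exact hcart.symm.trans hpol

theorem lintegral_gaussian_ne_zero (N : ℕ) :
    ∫⁻ x : Fin N → ℝ, ENNReal.ofReal (Real.exp (-∑ i, x i ^ 2)) ≠ 0 := by
  rw [Ne, lintegral_eq_zero_iff (by fun_prop)]
  intro h
  have h2 : ∀ᵐ x : Fin N → ℝ, False := by
    filter_upwards [h] with x hx
    simp only [Pi.zero_apply, ENNReal.ofReal_eq_zero] at hx
    exact absurd hx (not_le.2 (Real.exp_pos _))
  rw [ae_iff] at h2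
  simp only [not_false_eq_true, ofPred_true, Measure.measure_univ_eq_zero] at h2
  exact NeZero.ne _ h2

theorem lintegral_gaussian_ne_top (N : ℕ) :
    ∫⁻ x : Fin N → ℝ, ENNReal.ofReal (Real.exp (-∑ i, x i ^ 2)) ≠ ⊤ := by
  intro h
  have h1 := gaussian_mul_gaussMoment N 0
  rw [h, ENNReal.top_mul (gaussMoment_ne_zero (by norm_num))] at h1
  refine absurd h1.symm (ENNReal.mul_ne_top (gaussMoment_ne_top ?_) ?_)
  · have : (0 : ℝ) ≤ N := Nat.cast_nonneg N
    linarith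
  · simp

/-- The moment `∫ y^p dσ` of the surface measure on the half-sphere. -/
def sphereMoment (N : ℕ) (p : ℝ) : ℝ := ∫ X : USphere N, height (X : Ambient N) ^ p ∂(surf N)

theorem ae_height_pos (N : ℕ) : ∀ᵐ X : USphere N ∂(surf N), 0 < height (X : Ambient N) := by
  filter_upwards [ae_restrict_mem (measurableSet_upperHalf N)] with X hX using hX

theorem lintegral_height_rpow_ne_top (N : ℕ) {p : ℝ} (hp : -1 < p) :
    ∫⁻ X : USphere N, ENNReal.ofReal (height (X : Ambient N) ^ p) ∂(surf N) ≠ ⊤ := by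
  intro h
  have hN : (0 : ℝ) ≤ N := Nat.cast_nonneg N
  have h1 := gaussian_mul_gaussMoment N p
  rw [h, ENNReal.mul_top (gaussMoment_ne_zero (by linarith))] at h1
  exact ENNReal.mul_ne_top (lintegral_gaussian_ne_top N) (gaussMoment_ne_top hp) h1

theorem integrable_height_rpow (N : ℕ) {p : ℝ} (hp : -1 < p) :
    Integrable (fun X : USphere N => height (X : Ambient N) ^ p) (surf N) := by
  have hm : Measurable fun X : USphere N => height (X : Ambient N) ^ p := by fun_prop
  refine ⟨hm.aestronglyMeasurable, ?_⟩
  rw [hasFiniteIntegral_iff_ofReal]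
  · exact (lintegral_height_rpow_ne_top N hp).lt_top
  · filter_upwards [ae_height_pos N] with X hX
    exact Real.rpow_nonneg hX.le p

theorem ofReal_sphereMoment (N : ℕ) {p : ℝ} (hp : -1 < p) :
    ENNReal.ofReal (sphereMoment N p) =
      ∫⁻ X : USphere N, ENNReal.ofReal (height (X : Ambient N) ^ p) ∂(surf N) := by
  refine ofReal_integral_eq_lintegral_ofReal (integrable_height_rpow N hp) ?_
  filter_upwards [ae_height_pos N] with X hX
  exact Real.rpow_nonneg hX.le p

theorem sphereMoment_pos (N : ℕ) {p : ℝ} (hp : -1 < p) : 0 < sphereMoment N p := by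
  rw [← ENNReal.ofReal_pos, ofReal_sphereMoment N hp, pos_iff_ne_zero]
  intro h
  have h1 := gaussian_mul_gaussMoment N p
  rw [h, mul_zero, mul_eq_zero] at h1
  exact h1.elim (lintegral_gaussian_ne_zero N) (gaussMoment_ne_zero hp)

theorem sphereMoment_add_two (N : ℕ) {p : ℝ} (hp : -1 < p) :
    (N + p + 1) * sphereMoment N (p + 2) = (p + 1) * sphereMoment N p := by
  have hN : (0 : ℝ) ≤ N := Nat.cast_nonneg N
  have h1 := gaussian_mul_gaussMoment N p
  have h2 := gaussian_mul_gaussMoment N (p + 2)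
  rw [← ofReal_sphereMoment N hp] at h1
  rw [← ofReal_sphereMoment N (by linarith), gaussMoment_add_two hp, ← add_assoc,
    gaussMoment_add_two (by linarith), mul_left_comm, h1] at h2
  have hg0 := gaussMoment_ne_zero (p := N + p) (by linarith)
  have hgt := gaussMoment_ne_top (p := N + p) (by linarith)
  have h3 : gaussMoment (N + p) * (ENNReal.ofReal ((p + 1) / 2) * ENNReal.ofReal (sphereMoment N p))
      = gaussMoment (N + p) *
        (ENNReal.ofReal ((N + p + 1) / 2) * ENNReal.ofReal (sphereMoment N (p + 2))) := by
    rw [mul_left_comm, h2]; ring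
  rw [ENNReal.mul_right_inj hg0 hgt, ← ENNReal.ofReal_mul (by linarith),
    ← ENNReal.ofReal_mul (by linarith),
    ENNReal.ofReal_eq_ofReal_iff (mul_nonneg (by linarith) (sphereMoment_pos N hp).le)
      (mul_nonneg (by linarith) (sphereMoment_pos N (by linarith)).le)] at h3
  linarith

/-! ### The divergence theorem on the sphere -/

section Normalization

variable {E : Type*} [NormedAddCommGroup E] [InnerProductSpace ℝ E]

theorem hasFDerivAt_norm_of_ne_zero {P : E} (hP : P ≠ 0) :
    HasFDerivAt (fun Q : E => ‖Q‖) (innerSL ℝ (‖P‖⁻¹ • P)) P := by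
  have hP' : ‖P‖ ≠ 0 := norm_ne_zero_iff.2 hP
  have h := (hasStrictFDerivAt_norm_sq P).hasFDerivAt.sqrt (by positivity)
  simp only [Real.sqrt_sq (norm_nonneg _)] at h
  refine h.congr_fderiv ?_
  ext v
  simp
  field_simp

/-- The derivative of the radial projection `P ↦ P / |P|` is `|P|⁻¹` times the orthogonal
projection onto the hyperplane orthogonal to `P`. -/
theorem hasFDerivAt_normalize {P : E} (hP : P ≠ 0) :
    HasFDerivAt (fun Q : E => ‖Q‖⁻¹ • Q)
      (‖P‖⁻¹ • (ContinuousLinearMap.id ℝ E -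
        (innerSL ℝ (‖P‖⁻¹ • P)).smulRight (‖P‖⁻¹ • P))) P := by
  have hP' : ‖P‖ ≠ 0 := norm_ne_zero_iff.2 hP
  have h1 := (hasDerivAt_inv hP').comp_hasFDerivAt P (hasFDerivAt_norm_of_ne_zero hP)
  refine (h1.smul (hasFDerivAt_id P)).congr_fderiv ?_
  ext v
  simp [smul_smul, sub_eq_add_neg]
  congr 1
  field_simp

theorem contDiffAt_normalize {P : E} (hP : P ≠ 0) {n : WithTop ℕ∞} :
    ContDiffAt ℝ n (fun Q : E => ‖Q‖⁻¹ • Q) P :=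
  ((contDiffAt_norm ℝ hP).inv (norm_ne_zero_iff.2 hP)).smul contDiffAt_id

end Normalization

/-- The integral of a product of a radial and an angular function on `ℝ^{N+1}` factors. -/
theorem integral_radial_mul_angular {N : ℕ} (ρ : ℝ → ℝ) (g : Ambient N → ℝ) :
    ∫ P : Ambient N, ρ ‖P‖ * g (‖P‖⁻¹ • P) =
      (∫ r in Ioi (0 : ℝ), r ^ N * ρ r) *
        ∫ X : USphere N, g X ∂(volume : Measure (Ambient N)).toSphere := by
  have hdim : Module.finrank ℝ (Ambient N) - 1 = N := by simp
  have hmp := (volume : Measure (Ambient N)).measurePreserving_homeomorphUnitSphereProd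
  have hrad : ∫ r : Ioi (0 : ℝ), ρ r ∂(Measure.volumeIoiPow N) =
      ∫ r in Ioi (0 : ℝ), r ^ N * ρ r := by
    simp only [Measure.volumeIoiPow, ENNReal.ofReal]
    rw [integral_withDensity_eq_integral_smul (by fun_prop),
      integral_subtype_comap measurableSet_Ioi fun a : ℝ ↦ Real.toNNReal (a ^ N) • ρ a]
    refine setIntegral_congr_fun measurableSet_Ioi fun x hx ↦ ?_
    simp only [NNReal.smul_def, Real.coe_toNNReal _ (pow_nonneg (le_of_lt (mem_Ioi.1 hx)) _),
      smul_eq_mul]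
  calc ∫ P : Ambient N, ρ ‖P‖ * g (‖P‖⁻¹ • P)
      = ∫ P : ({0}ᶜ : Set (Ambient N)), ρ ‖(P : Ambient N)‖ *
          g (‖(P : Ambient N)‖⁻¹ • (P : Ambient N)) ∂(Measure.comap Subtype.val volume) := by
        rw [integral_subtype_comap (measurableSet_singleton _).compl
          (fun P : Ambient N => ρ ‖P‖ * g (‖P‖⁻¹ • P)), restrict_compl_singleton]
    _ = ∫ q : USphere N × Ioi (0 : ℝ), g q.1 * ρ q.2
          ∂((volume : Measure (Ambient N)).toSphere.prod (Measure.volumeIoiPow N)) := by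
        rw [hdim] at hmp
        rw [← hmp.integral_comp (Homeomorph.measurableEmbedding _)]
        refine integral_congr_ae (.of_forall fun P => ?_)
        simp [mul_comm]
    _ = _ := by
        rw [integral_prod_mul (fun X : USphere N => g X) (fun r : Ioi (0 : ℝ) => ρ r), hrad, mul_comm]

/-- The integral of the divergence of a compactly supported `C¹` vector field vanishes. -/
theorem integral_trace_fderiv_eq_zero {N : ℕ} {V : Ambient N → Ambient N} (hV : ContDiff ℝ 1 V)
    (hc : HasCompactSupport V) :
    ∫ P, LinearMap.trace ℝ (Ambient N) (fderiv ℝ V P : Ambient N →ₗ[ℝ] Ambient N) = 0 := by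
  have hcont : Continuous (fderiv ℝ V) := hV.continuous_fderiv one_ne_zero
  have hint : ∀ v, Integrable fun P => fderiv ℝ V P v := fun v =>
    (hcont.clm_apply continuous_const).integrable_of_hasCompactSupport (hc.fderiv_apply ℝ v)
  have hzero : ∀ v, ∫ P, fderiv ℝ V P v = 0 := by
    intro v
    have h := integral_smul_fderiv_eq_neg_fderiv_smul_of_integrable (μ := volume)
      (f := fun _ : Ambient N => (1 : ℝ)) (g := V) (v := v) (by simp) (by simpa using hint v)
      (by simpa using hV.continuous.integrable_of_hasCompactSupport hc)
      (fun _ _ => by fun_prop) (fun P _ => hV.differentiable one_ne_zero P)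
    simpa using h
  have hb := fun P => LinearMap.trace_eq_sum_inner (𝕜 := ℝ)
    (fderiv ℝ V P : Ambient N →ₗ[ℝ] Ambient N) (EuclideanSpace.basisFun (Fin (N + 1)) ℝ)
  simp only [hb, ContinuousLinearMap.coe_coe]
  rw [integral_finsetSum _ fun i _ => (hint _).const_inner _]
  refine Finset.sum_eq_zero fun i _ => ?_
  rw [integral_inner (hint _), hzero, inner_zero_right]

/-- The divergence theorem on the whole sphere. The tangent field is extended radially to a
compactly supported field of `ℝ^{N+1}`, whose divergence is a radial factor times `tangDiv`. -/
theorem integral_tangDiv_eq_zero {N : ℕ} {Ψ : Ambient N → Ambient N} (hΨ : ContDiff ℝ 1 Ψ)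
    (ht : ∀ X : USphere N, inner ℝ (X : Ambient N) (Ψ X) = 0) :
    ∫ X : USphere N, tangDiv Ψ X ∂(volume : Measure (Ambient N)).toSphere = 0 := by
  -- A radial cutoff supported in `1/2 ≤ |P| ≤ 3/2`. The factor `‖P‖` in `V` cancels the `‖P‖⁻¹`
  -- in the derivative of the radial projection.
  let χ : ContDiffBump (1 : ℝ) := ⟨1 / 4, 1 / 2, by norm_num, by norm_num⟩
  have hχ0 : ∀ r : ℝ, r < 1 / 2 ∨ 3 / 2 < r → χ r = 0 := by
    intro r hr
    refine χ.zero_of_le_dist ?_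
    change (1 / 2 : ℝ) ≤ dist r 1
    rw [Real.dist_eq, le_abs]
    rcases hr with hr | hr
    · right; linarith
    · left; linarith
  set V : Ambient N → Ambient N := fun P => (‖P‖ * χ ‖P‖) • Ψ (‖P‖⁻¹ • P) with hVdef
  have hV : ContDiff ℝ 1 V := by
    rw [contDiff_iff_contDiffAt]
    intro P
    by_cases hP : P = 0
    · have h0 : V =ᶠ[𝓝 P] fun _ => 0 := by
        have : Metric.ball (0 : Ambient N) (1 / 2) ∈ 𝓝 P := by
          rw [hP]; exact Metric.ball_mem_nhds _ (by norm_num)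
        filter_upwards [this] with Q hQ
        have : ‖Q‖ < 1 / 2 := by simpa using hQ
        simp [hVdef, hχ0 _ (Or.inl this)]
      exact contDiffAt_const.congr_of_eventuallyEq h0
    · have hn : ContDiffAt ℝ 1 (fun Q : Ambient N => ‖Q‖) P := contDiffAt_norm ℝ hP
      exact (hn.mul (χ.contDiffAt.comp P hn)).smul (hΨ.contDiffAt.comp P (contDiffAt_normalize hP))
  have hc : HasCompactSupport V := by
    refine HasCompactSupport.intro (isCompact_closedBall (0 : Ambient N) 2) fun P hP => ?_
    have : 2 < ‖P‖ := by simpa using hP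
    simp [hVdef, hχ0 ‖P‖ (Or.inr (by linarith))]
  have hdiv : ∀ P : Ambient N, P ≠ 0 →
      LinearMap.trace ℝ (Ambient N) (fderiv ℝ V P : Ambient N →ₗ[ℝ] Ambient N)
        = χ ‖P‖ * tangDiv Ψ (‖P‖⁻¹ • P) := by
    intro P hP
    have hP' : ‖P‖ ≠ 0 := norm_ne_zero_iff.2 hP
    -- The derivative of the radial factor contributes nothing to the trace, as the field is tangent.
    have hη : DifferentiableAt ℝ (fun r : ℝ => r * χ r) ‖P‖ :=
      differentiableAt_id.mul (χ.contDiff (n := 1)).contDiffAt.differentiableAt_one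
    have hη' := hη.hasDerivAt.comp_hasFDerivAt P (hasFDerivAt_norm_of_ne_zero hP)
    have hΨ' : HasFDerivAt Ψ (fderiv ℝ Ψ (‖P‖⁻¹ • P)) (‖P‖⁻¹ • P) :=
      (hΨ.differentiable one_ne_zero _).hasFDerivAt
    have hcomp := HasFDerivAt.comp (g := Ψ) (f := fun Q : Ambient N => ‖Q‖⁻¹ • Q) P hΨ'
      (hasFDerivAt_normalize hP)
    have hd : fderiv ℝ V P = _ := (hη'.smul hcomp).fderiv
    have htan : inner ℝ (‖P‖⁻¹ • P) (Ψ (‖P‖⁻¹ • P)) = 0 :=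
      ht ⟨‖P‖⁻¹ • P, by simp [norm_smul, hP']⟩
    have htr : LinearMap.trace ℝ (Ambient N) ((fderiv ℝ Ψ (‖P‖⁻¹ • P) ∘L
        (‖P‖⁻¹ • (ContinuousLinearMap.id ℝ (Ambient N) -
          (innerSL ℝ (‖P‖⁻¹ • P)).smulRight (‖P‖⁻¹ • P)))) : Ambient N →L[ℝ] Ambient N) =
        ‖P‖⁻¹ * tangDiv Ψ (‖P‖⁻¹ • P) := by
      have : (((fderiv ℝ Ψ (‖P‖⁻¹ • P) ∘L
        (‖P‖⁻¹ • (ContinuousLinearMap.id ℝ (Ambient N) -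
          (innerSL ℝ (‖P‖⁻¹ • P)).smulRight (‖P‖⁻¹ • P)))) : Ambient N →L[ℝ] Ambient N) :
            Ambient N →ₗ[ℝ] Ambient N) = ‖P‖⁻¹ • ((fderiv ℝ Ψ (‖P‖⁻¹ • P) :
              Ambient N →ₗ[ℝ] Ambient N) - (innerSL ℝ (‖P‖⁻¹ • P) : Ambient N →ₗ[ℝ] ℝ).smulRight
                (fderiv ℝ Ψ (‖P‖⁻¹ • P) (‖P‖⁻¹ • P))) := by
        ext1 v
        simp only [ContinuousLinearMap.coe_coe, ContinuousLinearMap.comp_apply,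
          smul_apply, sub_apply,
          ContinuousLinearMap.id_apply, ContinuousLinearMap.smulRight_apply, map_smul, map_sub,
          LinearMap.smul_apply, LinearMap.sub_apply, LinearMap.smulRight_apply]
      rw [this, map_smul, map_sub, LinearMap.trace_smulRight, smul_eq_mul]
      rfl
    have htr2 : LinearMap.trace ℝ (Ambient N) (((deriv (fun r => r * χ r) ‖P‖ •
        innerSL ℝ (‖P‖⁻¹ • P)).smulRight (Ψ (‖P‖⁻¹ • P)) : Ambient N →L[ℝ] Ambient N) :
          Ambient N →ₗ[ℝ] Ambient N) = 0 := by
      refine (LinearMap.trace_smulRight _ _).trans ?_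
      simp only [ContinuousLinearMap.coe_coe, smul_apply, innerSL_apply_apply, htan, smul_zero]
    rw [hd, ContinuousLinearMap.toLinearMap_add, map_add, ContinuousLinearMap.toLinearMap_smul,
      map_smul, htr]
    simp only [Function.comp_apply]
    rw [htr2, add_zero, smul_eq_mul]
    field_simp
  have hpos : 0 < ∫ r in Ioi (0 : ℝ), r ^ N * χ r := by
    have hcs : HasCompactSupport fun r : ℝ => r ^ N * χ r := χ.hasCompactSupport.mul_left
    rw [setIntegral_pos_iff_support_of_nonneg_ae]
    · refine lt_of_lt_of_le (?_ : 0 < volume (Metric.ball (1 : ℝ) (1 / 2))) (measure_mono ?_)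
      · exact Metric.measure_ball_pos _ _ (by norm_num)
      · intro r hr
        have hr2 : r ∈ Function.support χ := by rw [χ.support_eq]; exact hr
        have hr0 : 0 < r := by
          rw [Metric.mem_ball, Real.dist_eq, abs_lt] at hr; linarith
        exact ⟨mul_ne_zero (pow_pos hr0 _).ne' hr2, hr0⟩
    · filter_upwards [ae_restrict_mem measurableSet_Ioi] with r hr
      exact mul_nonneg (pow_nonneg (le_of_lt (mem_Ioi.1 hr)) _) χ.nonneg
    · exact (((continuous_pow N).mul χ.continuous).integrable_of_hasCompactSupport hcs).integrableOn
  have hmain := integral_trace_fderiv_eq_zero hV hc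
  rw [integral_congr_ae (g := fun P : Ambient N => χ ‖P‖ * tangDiv Ψ (‖P‖⁻¹ • P))
    (by filter_upwards [Measure.ae_ne volume (0 : Ambient N)] with P hP using hdiv P hP),
    integral_radial_mul_angular] at hmain
  exact (mul_eq_zero.1 hmain).resolve_left hpos.ne'

/-! ### Smooth functions in the weighted Sobolev space -/

variable {N : ℕ}

theorem continuous_gradient {w : Ambient N → ℝ} (hw : ContDiff ℝ ∞ w) :
    Continuous (gradient w) := by
  unfold gradient
  exact (InnerProductSpace.toDual ℝ (Ambient N)).symm.continuous.comp
    (hw.continuous_fderiv (by simp))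

theorem continuous_tangGrad {w : Ambient N → ℝ} (hw : ContDiff ℝ ∞ w) :
    Continuous (tangGrad w) := by
  have := continuous_gradient hw
  unfold tangGrad
  fun_prop

theorem continuous_tangDiv {Φ : Ambient N → Ambient N} (hΦ : ContDiff ℝ ∞ Φ) :
    Continuous (tangDiv Φ) := by
  have hD : Continuous (fderiv ℝ Φ) := hΦ.continuous_fderiv (by simp)
  have hb := fun P => LinearMap.trace_eq_sum_inner (𝕜 := ℝ)
    (fderiv ℝ Φ P : Ambient N →ₗ[ℝ] Ambient N) (EuclideanSpace.basisFun (Fin (N + 1)) ℝ)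
  unfold tangDiv
  simp only [hb, ContinuousLinearMap.coe_coe]
  fun_prop

theorem inner_self_tangGrad (w : Ambient N → ℝ) {X : Ambient N} (hX : ‖X‖ = 1) :
    inner ℝ X (tangGrad w X) = 0 := by
  simp [tangGrad, inner_sub_right, inner_smul_right, hX]

theorem tangDiv_smul {w : Ambient N → ℝ} {Φ : Ambient N → Ambient N} {X : Ambient N}
    (hw : DifferentiableAt ℝ w X) (hΦ : DifferentiableAt ℝ Φ X) (hX : inner ℝ X (Φ X) = 0) :
    tangDiv (fun P => w P • Φ P) X = w X * tangDiv Φ X + inner ℝ (tangGrad w X) (Φ X) := by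
  have hd := fderiv_fun_smul hw hΦ
  have htr : LinearMap.trace ℝ (Ambient N) (((fderiv ℝ w X).smulRight (Φ X) :
      Ambient N →L[ℝ] Ambient N) : Ambient N →ₗ[ℝ] Ambient N) = fderiv ℝ w X (Φ X) :=
    LinearMap.trace_smulRight _ _
  rw [tangDiv, hd, ContinuousLinearMap.toLinearMap_add, map_add,
    ContinuousLinearMap.toLinearMap_smul, map_smul, htr]
  simp only [tangDiv, tangGrad, add_apply, smul_apply, ContinuousLinearMap.smulRight_apply,
    inner_add_right, inner_sub_left, inner_smul_right, inner_smul_left, hX, inner_gradient_left,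
    smul_eq_mul]
  simp
  ring

/-- A smooth function has its classical tangential gradient as weak tangential gradient. -/
theorem hasWeakTangGrad_of_contDiff {w : Ambient N → ℝ} (hw : ContDiff ℝ ∞ w) :
    HasWeakTangGrad (fun X : USphere N => w X) (fun X => tangGrad w X) := by
  refine ⟨.of_forall fun X => inner_self_tangGrad w (norm_eq_of_mem_sphere X),
    fun Φ hΦ _ hsupp htan => ?_⟩
  have hΨ : ContDiff ℝ ∞ fun P => w P • Φ P := hw.smul hΦ
  have h0 := integral_tangDiv_eq_zero (hΨ.of_le (by simp)) fun X => by
    rw [inner_smul_right, htan X, mul_zero]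
  have hprod : ∀ X : USphere N, tangDiv (fun P => w P • Φ P) X =
      w X * tangDiv Φ X + inner ℝ (tangGrad w X) (Φ X) := fun X =>
    tangDiv_smul (hw.differentiable (by simp) _) (hΦ.differentiable (by simp) _) (htan X)
  have hoff : ∀ X : USphere N, X ∉ upperHalf N → tangDiv (fun P => w P • Φ P) X = 0 := by
    intro X hX
    have hX' : (X : Ambient N) ∉ tsupport Φ := fun h => hX (hsupp h)
    rw [hprod, tangDiv, fderiv_of_notMem_tsupport ℝ hX', image_eq_zero_of_notMem_tsupport hX']
    simp
  rw [← setIntegral_eq_integral_of_forall_compl_eq_zero hoff] at h0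
  change ∫ X : USphere N, tangDiv (fun P => w P • Φ P) X ∂(surf N) = 0 at h0
  simp only [hprod] at h0
  have hi : ∀ f : USphere N → ℝ, Continuous f → Integrable f (surf N) := fun f hf =>
    hf.integrable_of_hasCompactSupport (HasCompactSupport.of_compactSpace f)
  have hc := continuous_tangDiv hΦ
  have hg := continuous_tangGrad hw
  have hwc := hw.continuous
  have hΦc := hΦ.continuous
  rw [integral_add (hi _ (by fun_prop)) (hi _ (by fun_prop))] at h0
  linarith

theorem lintegral_weightedSurf (s : ℝ) {f : USphere N → ℝ≥0∞} (hf : Measurable f) :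
    ∫⁻ X, f X ∂(weightedSurf N s) =
      ∫⁻ X, ENNReal.ofReal (height (X : Ambient N) ^ (1 - 2 * s)) * f X ∂(surf N) := by
  rw [weightedSurf, lintegral_withDensity_eq_lintegral_mul _ (by fun_prop) hf]
  rfl

theorem integral_weightedSurf (s : ℝ) (f : USphere N → ℝ) :
    ∫ X, f X ∂(weightedSurf N s) =
      ∫ X, height (X : Ambient N) ^ (1 - 2 * s) * f X ∂(surf N) := by
  rw [weightedSurf, integral_withDensity_eq_integral_toReal_smul (by fun_prop) (by simp)]
  refine integral_congr_ae ?_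
  filter_upwards [ae_height_pos N] with X hX
  rw [ENNReal.toReal_ofReal (Real.rpow_nonneg hX.le _), smul_eq_mul]

theorem ae_weightedSurf_height_pos (N : ℕ) (s : ℝ) :
    ∀ᵐ X : USphere N ∂(weightedSurf N s), 0 < height (X : Ambient N) :=
  (withDensity_absolutelyContinuous _ _).ae_le (ae_height_pos N)

theorem isFiniteMeasure_weightedSurf (N : ℕ) {s : ℝ} (hs : s < 1) :
    IsFiniteMeasure (weightedSurf N s) :=
  isFiniteMeasure_withDensity (lintegral_height_rpow_ne_top N (by linarith))

theorem integral_weightedSurf_rpow (N : ℕ) (s p : ℝ) :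
    ∫ X : USphere N, height (X : Ambient N) ^ p ∂(weightedSurf N s) =
      sphereMoment N (1 - 2 * s + p) := by
  rw [integral_weightedSurf]
  refine integral_congr_ae ?_
  filter_upwards [ae_height_pos N] with X hX
  rw [Real.rpow_add hX]

theorem integrable_weightedSurf_rpow (N : ℕ) {s p : ℝ} (hp : 0 < 2 - 2 * s + p) :
    Integrable (fun X : USphere N => height (X : Ambient N) ^ p) (weightedSurf N s) := by
  rw [weightedSurf, integrable_withDensity_iff_integrable_smul' (by fun_prop) (by simp)]
  refine (integrable_height_rpow N (p := 1 - 2 * s + p) (by linarith)).congr ?_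
  filter_upwards [ae_height_pos N] with X hX
  rw [ENNReal.toReal_ofReal (Real.rpow_nonneg hX.le _), smul_eq_mul, Real.rpow_add hX]

theorem memLp_of_continuous {F : Type*} [NormedAddCommGroup F] [SecondCountableTopology F]
    [MeasurableSpace F] [BorelSpace F] {μ : Measure (USphere N)} [IsFiniteMeasure μ]
    {f : USphere N → F} (hf : Continuous f) : MemLp f 2 μ := by
  obtain ⟨C, hC⟩ := isCompact_univ.exists_bound_of_continuousOn hf.continuousOn
  exact MemLp.of_bound hf.aestronglyMeasurable C (.of_forall fun X => hC X (mem_univ X))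

theorem memH1_of_contDiff {s : ℝ} (hs : s < 1) {w : Ambient N → ℝ} (hw : ContDiff ℝ ∞ w) :
    MemH1 s (fun X : USphere N => w X) (fun X => tangGrad w X) := by
  have := isFiniteMeasure_weightedSurf N hs
  exact ⟨memLp_of_continuous (hw.continuous.comp continuous_subtype_val),
    memLp_of_continuous ((continuous_tangGrad hw).comp continuous_subtype_val),
    hasWeakTangGrad_of_contDiff hw⟩

theorem vanishesOff_of_contDiff (s : ℝ) {Ω : Set (equator N)} {w : Ambient N → ℝ}
    (hw : ContDiff ℝ ∞ w) (h0 : ∀ X : equator N, X ∉ Ω → w X = 0) :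
    VanishesOff s Ω (fun X : USphere N => w X) (fun X => tangGrad w X) :=
  ⟨fun _ => w, fun _ => hw, fun _ => h0, by simp, by simp⟩

theorem firstEigenvalue_nonneg (s : ℝ) (Ω : Set (equator N)) : 0 ≤ firstEigenvalue s Ω := by
  refine Real.sInf_nonneg ?_
  rintro R ⟨u, G, -, -, -, rfl⟩
  positivity

/-- The Rayleigh quotient of a smooth function bounds the first eigenvalue from above. -/
theorem firstEigenvalue_mul_le {s : ℝ} (hs : s < 1) {Ω : Set (equator N)} {w : Ambient N → ℝ}
    (hw : ContDiff ℝ ∞ w) (h0 : ∀ X : equator N, X ∉ Ω → w X = 0) :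
    firstEigenvalue s Ω * ∫ X : USphere N, w X ^ 2 ∂(weightedSurf N s) ≤
      ∫ X : USphere N, ‖tangGrad w X‖ ^ 2 ∂(weightedSurf N s) := by
  have hnn : 0 ≤ ∫ X : USphere N, w X ^ 2 ∂(weightedSurf N s) := by positivity
  rcases hnn.eq_or_lt with h | h
  · rw [← h, mul_zero]; positivity
  · rw [← le_div_iff₀ h]
    refine csInf_le ⟨0, ?_⟩ ⟨_, _, memH1_of_contDiff hs hw, vanishesOff_of_contDiff s hw h0,
      h.ne', rfl⟩
    rintro R ⟨u, G, -, -, -, rfl⟩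
    positivity

/-! ### First eigenvalues of the empty set and of the whole equator -/

theorem gradient_comp_height {φ : ℝ → ℝ} {X : Ambient N} (hφ : DifferentiableAt ℝ φ (height X)) :
    gradient (fun P : Ambient N => φ (height P)) X =
      deriv φ (height X) • EuclideanSpace.single (Fin.last N) 1 := by
  refine HasGradientAt.gradient ?_
  rw [hasGradientAt_iff_hasFDerivAt]
  have h1 : HasFDerivAt (height : Ambient N → ℝ)
      (EuclideanSpace.proj (Fin.last N) : Ambient N →L[ℝ] ℝ) X :=
    (EuclideanSpace.proj (Fin.last N) : Ambient N →L[ℝ] ℝ).hasFDerivAt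
  refine (hφ.hasDerivAt.comp_hasFDerivAt X h1).congr_fderiv ?_
  ext v
  simp [EuclideanSpace.inner_single_left]

/-- The tangential gradient of the coordinate `y` has square length `1 - y²`. -/
theorem norm_sq_tangGrad_comp_height {φ : ℝ → ℝ} {X : Ambient N} (hX : ‖X‖ = 1)
    (hφ : DifferentiableAt ℝ φ (height X)) :
    ‖tangGrad (fun P : Ambient N => φ (height P)) X‖ ^ 2 =
      deriv φ (height X) ^ 2 * (1 - height X ^ 2) := by
  have hin : inner ℝ X (EuclideanSpace.single (Fin.last N) (1 : ℝ)) = height X := by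
    simp [height, EuclideanSpace.inner_single_right]
  rw [tangGrad, gradient_comp_height hφ, norm_sub_sq_real]
  simp only [inner_smul_left, inner_smul_right, norm_smul, real_inner_comm, hin, hX, mul_pow]
  simp
  have := sq_abs (deriv φ (height X))
  ring_nf
  simp [sq_abs]
  ring

theorem abs_height_le_one (X : USphere N) : |height (X : Ambient N)| ≤ 1 := by
  have := EuclideanSpace.norm_sq_eq (X : Ambient N)
  rw [norm_eq_of_mem_sphere, Fin.sum_univ_castSucc] at this
  have h2 : 0 ≤ ∑ i : Fin N, ‖(X : Ambient N) i.castSucc‖ ^ 2 := by positivity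
  rw [← sq_le_one_iff_abs_le_one, ← sq_abs]
  change ‖(X : Ambient N) (Fin.last N)‖ ^ 2 ≤ 1
  linarith

/-- An approximation of `|y| ^ (2 s)` that is smooth for `δ > 0` and vanishes at `y = 0`. -/
def smoothPow (s δ : ℝ) (y : ℝ) : ℝ := (y ^ 2 + δ) ^ s - δ ^ s

theorem contDiff_smoothPow (s : ℝ) {δ : ℝ} (hδ : 0 < δ) : ContDiff ℝ ∞ (smoothPow s δ) := by
  unfold smoothPow
  exact ((contDiff_id.pow 2).add contDiff_const).rpow_const_of_ne
    (fun y => by simp only [id]; positivity) |>.sub contDiff_const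

theorem deriv_smoothPow_sq_le {s δ y : ℝ} (hs : 0 < s) (hs1 : s < 1) (hδ : 0 < δ) (hy : 0 < y) :
    deriv (smoothPow s δ) y ^ 2 ≤ 4 * s ^ 2 * y ^ (4 * s - 2) := by
  have hpos : 0 < y ^ 2 + δ := by positivity
  have h1 : HasDerivAt (smoothPow s δ) (2 * y * s * (y ^ 2 + δ) ^ (s - 1)) y := by
    have h2 : HasDerivAt (fun y : ℝ => y ^ 2 + δ) (2 * y) y := by
      simpa using (hasDerivAt_pow 2 y).add_const δ
    exact (h2.rpow_const (Or.inl hpos.ne')).sub_const _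
  have h3 : (y ^ 2 + δ) ^ (s - 1) ≤ (y ^ 2) ^ (s - 1) :=
    Real.rpow_le_rpow_of_nonpos (by positivity) (by linarith) (by linarith)
  have h4 : (y ^ 2 * ((y ^ 2) ^ (s - 1)) ^ 2 : ℝ) = y ^ (4 * s - 2) := by
    rw [← Real.rpow_natCast y 2, ← Real.rpow_mul hy.le, ← Real.rpow_natCast _ 2,
      ← Real.rpow_mul hy.le, ← Real.rpow_add hy]
    congr 1
    push_cast
    ring
  calc deriv (smoothPow s δ) y ^ 2
      = 4 * s ^ 2 * (y ^ 2 * ((y ^ 2 + δ) ^ (s - 1)) ^ 2) := by rw [h1.deriv]; ring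
    _ ≤ 4 * s ^ 2 * (y ^ 2 * ((y ^ 2) ^ (s - 1)) ^ 2) := by gcongr
    _ = _ := by rw [h4]

theorem le_smoothPow_sq {s δ y : ℝ} (hs : 0 < s) (hδ : 0 < δ) (hy : 0 < y) (hy1 : y ≤ 1) :
    y ^ (4 * s) - 2 * δ ^ s ≤ smoothPow s δ y ^ 2 := by
  have h0 : y ^ (2 * s) - δ ^ s ≤ smoothPow s δ y := by
    rw [smoothPow, Real.rpow_mul hy.le, Real.rpow_two]
    gcongr
    linarith
  have hA1 : y ^ (2 * s) ≤ 1 := Real.rpow_le_one hy.le hy1 (by linarith)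
  have hA0 : 0 < y ^ (2 * s) := Real.rpow_pos_of_pos hy _
  have hB : 0 < δ ^ s := Real.rpow_pos_of_pos hδ _
  have hsq : y ^ (4 * s) = (y ^ (2 * s)) ^ 2 := by
    rw [← Real.rpow_natCast, ← Real.rpow_mul hy.le]
    congr 1
    push_cast
    ring
  rw [hsq]
  rcases le_total (δ ^ s) (y ^ (2 * s)) with h | h
  · have : (y ^ (2 * s) - δ ^ s) ^ 2 ≤ smoothPow s δ y ^ 2 :=
      pow_le_pow_left₀ (by linarith) h0 2
    nlinarith
  -- Here the left-hand side is not positive.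
  · nlinarith [sq_nonneg (smoothPow s δ y)]

/-- The function `y ^ (2 s)`, whose extension homogeneous of degree `2 s` solves the degenerate
equation and vanishes for `y = 0`, bounds the first eigenvalue of the empty set. -/
theorem firstEigenvalue_empty_le {s : ℝ} (hs0 : 0 < s) (hs1 : s < 1) :
    firstEigenvalue s (∅ : Set (equator N)) ≤ 2 * s * N := by
  have hfin := isFiniteMeasure_weightedSurf N hs1
  set lam := firstEigenvalue s (∅ : Set (equator N)) with hlam
  have hlam0 : 0 ≤ lam := firstEigenvalue_nonneg _ _
  set m := sphereMoment N (2 * s + 1) with hm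
  set μ := (weightedSurf N s).real univ with hμ
  have hmpos : 0 < m := sphereMoment_pos N (by linarith)
  have hrec : (N + 2 * s) * m = 2 * s * sphereMoment N (2 * s - 1) := by
    have := sphereMoment_add_two N (p := 2 * s - 1) (by linarith)
    rw [show 2 * s - 1 + 2 = 2 * s + 1 by ring] at this
    linarith
  have hi1 := integrable_weightedSurf_rpow N (s := s) (p := 4 * s - 2) (by linarith)
  have hi2 := integrable_weightedSurf_rpow N (s := s) (p := 4 * s) (by linarith)
  have key : ∀ ε : ℝ, 0 < ε → lam * (m - 2 * ε * μ) ≤ 2 * s * N * m := by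
    intro ε hε
    -- The error term of `le_smoothPow_sq` is then `2 ε`.
    set δ : ℝ := ε ^ (1 / s) with hδdef
    have hδ : 0 < δ := Real.rpow_pos_of_pos hε _
    have hδs : δ ^ s = ε := by
      rw [hδdef, ← Real.rpow_mul hε.le, one_div_mul_cancel hs0.ne', Real.rpow_one]
    have hheight : ContDiff ℝ ∞ (height : Ambient N → ℝ) :=
      (EuclideanSpace.proj (Fin.last N) : Ambient N →L[ℝ] ℝ).contDiff
    have hw : ContDiff ℝ ∞ fun P : Ambient N => smoothPow s δ (height P) :=
      (contDiff_smoothPow s hδ).comp hheight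
    have hle := firstEigenvalue_mul_le hs1 (Ω := ∅) hw fun X _ => by
      rw [X.2.2]; simp [smoothPow]
    have hden : m - 2 * ε * μ ≤
        ∫ X : USphere N, smoothPow s δ (height (X : Ambient N)) ^ 2 ∂(weightedSurf N s) := by
      have h1 : ∫ X : USphere N, (height (X : Ambient N) ^ (4 * s) - 2 * ε) ∂(weightedSurf N s) =
          m - 2 * ε * μ := by
        rw [integral_sub hi2 (integrable_const _), integral_weightedSurf_rpow, integral_const,
          smul_eq_mul, hm, show 1 - 2 * s + 4 * s = 2 * s + 1 by ring]
        ring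
      rw [← h1]
      refine integral_mono_ae (hi2.sub (integrable_const _)) ?_ ?_
      · exact (memLp_of_continuous (hw.continuous.comp continuous_subtype_val)).integrable_sq
      · filter_upwards [ae_weightedSurf_height_pos N s] with X hX
        rw [← hδs]
        exact le_smoothPow_sq hs0 hδ hX (abs_le.1 (abs_height_le_one X)).2
    have hnum : ∫ X : USphere N, ‖tangGrad (fun P => smoothPow s δ (height P)) (X : Ambient N)‖ ^ 2
        ∂(weightedSurf N s) ≤ 2 * s * N * m := by
      have h1 : ∫ X : USphere N, 4 * s ^ 2 * (height (X : Ambient N) ^ (4 * s - 2) -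
          height (X : Ambient N) ^ (4 * s)) ∂(weightedSurf N s) = 2 * s * N * m := by
        rw [integral_const_mul, integral_sub hi1 hi2, integral_weightedSurf_rpow,
          integral_weightedSurf_rpow, show 1 - 2 * s + 4 * s = 2 * s + 1 by ring,
          show 1 - 2 * s + (4 * s - 2) = 2 * s - 1 by ring, ← hm]
        -- The moment recursion turns the energy of `y ^ (2 s)` into `2 s N` times its square norm.
        linear_combination (-2 * s) * hrec
      rw [← h1]
      refine integral_mono_ae ?_ ((hi1.sub hi2).const_mul _) ?_
      · exact (memLp_of_continuous
          ((continuous_tangGrad hw).comp continuous_subtype_val).norm).integrable_sq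
      · filter_upwards [ae_weightedSurf_height_pos N s] with X hX
        have hX1 := abs_height_le_one X
        have hsq : height (X : Ambient N) ^ 2 ≤ 1 := (sq_le_one_iff_abs_le_one _).2 hX1
        rw [norm_sq_tangGrad_comp_height (norm_eq_of_mem_sphere X)
          ((contDiff_smoothPow s hδ).differentiable (by simp) _)]
        have h4 : height (X : Ambient N) ^ (4 * s) =
            height (X : Ambient N) ^ (4 * s - 2) * height (X : Ambient N) ^ 2 := by
          rw [← Real.rpow_two, ← Real.rpow_add hX]
          congr 1
          ring
        calc _ ≤ 4 * s ^ 2 * height (X : Ambient N) ^ (4 * s - 2) *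
              (1 - height (X : Ambient N) ^ 2) :=
              mul_le_mul_of_nonneg_right (deriv_smoothPow_sq_le hs0 hs1 hδ hX) (by linarith)
          _ = _ := by rw [h4]; ring
    exact (mul_le_mul_of_nonneg_left hden hlam0).trans (hle.trans hnum)
  have hlim : Tendsto (fun ε : ℝ => lam * (m - 2 * ε * μ)) (𝓝[>] 0) (𝓝 (lam * m)) := by
    have : Continuous fun ε : ℝ => lam * (m - 2 * ε * μ) := by fun_prop
    simpa using (this.tendsto 0).mono_left nhdsWithin_le_nhds
  have hfinal : lam * m ≤ 2 * s * N * m :=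
    le_of_tendsto hlim (by filter_upwards [self_mem_nhdsWithin] with ε hε using key ε hε)
  exact le_of_mul_le_mul_right hfinal hmpos

/-- Constants are admissible for the whole equator. -/
theorem firstEigenvalue_univ {s : ℝ} (hs1 : s < 1) :
    firstEigenvalue s (univ : Set (equator N)) = 0 := by
  refine le_antisymm ?_ (firstEigenvalue_nonneg _ _)
  have h := firstEigenvalue_mul_le (N := N) hs1 (Ω := univ) (w := fun _ => 1) contDiff_const
    fun X hX => absurd (mem_univ X) hX
  have hpos : 0 < sphereMoment N (1 - 2 * s + 0) := sphereMoment_pos N (by linarith)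
  rw [← integral_weightedSurf_rpow] at hpos
  simp only [Real.rpow_zero] at hpos
  simp only [tangGrad, gradient_fun_const, one_pow] at h
  simp only [inner_zero_right] at h
  refine le_of_mul_le_mul_right (h.trans ?_) hpos
  simp

/-! ### Weighted integrals over the half-ball and along segments -/

/-- Cauchy–Schwarz with a weight `ρ`. -/
theorem lintegral_sq_le_mul {α : Type*} [MeasurableSpace α] {μ : Measure α} {ρ g : α → ℝ≥0∞}
    (hρ : Measurable ρ) (hg : Measurable g) (h : ∀ᵐ t ∂μ, ρ t ≠ 0 ∧ ρ t ≠ ⊤) :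
    (∫⁻ t, g t ∂μ) ^ 2 ≤ (∫⁻ t, (ρ t)⁻¹ ∂μ) * ∫⁻ t, ρ t * g t ^ 2 ∂μ := by
  have h1 : ∫⁻ t, g t ∂μ =
      ∫⁻ t, ((fun t => ρ t ^ (-(1 / 2) : ℝ)) * (fun t => ρ t ^ (1 / 2 : ℝ) * g t)) t ∂μ := by
    refine lintegral_congr_ae ?_
    filter_upwards [h] with t ht
    simp only [Pi.mul_apply]
    rw [← mul_assoc, ← ENNReal.rpow_add _ _ ht.1 ht.2]
    simp
  have h2 := ENNReal.lintegral_mul_le_Lp_mul_Lq μ Real.HolderConjugate.two_two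
    (f := fun t => ρ t ^ (-(1 / 2) : ℝ)) (g := fun t => ρ t ^ (1 / 2 : ℝ) * g t)
    (by fun_prop) (by fun_prop)
  have e1 : ∀ t, (ρ t ^ (-(1 / 2) : ℝ)) ^ (2 : ℝ) = (ρ t)⁻¹ := by
    intro t
    rw [← ENNReal.rpow_mul]
    norm_num [ENNReal.rpow_neg_one]
  have e2 : ∀ t, (ρ t ^ (1 / 2 : ℝ) * g t) ^ (2 : ℝ) = ρ t * g t ^ 2 := by
    intro t
    rw [ENNReal.mul_rpow_of_nonneg _ _ two_pos.le, ← ENNReal.rpow_mul]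
    norm_num
  rw [← h1] at h2
  simp only [e1, e2] at h2
  calc (∫⁻ t, g t ∂μ) ^ 2
      ≤ ((∫⁻ t, (ρ t)⁻¹ ∂μ) ^ (1 / 2 : ℝ) * (∫⁻ t, ρ t * g t ^ 2 ∂μ) ^ (1 / 2 : ℝ)) ^ 2 := by gcongr
    _ = _ := by
      rw [mul_pow, ← ENNReal.rpow_natCast, ← ENNReal.rpow_natCast, ← ENNReal.rpow_mul,
        ← ENNReal.rpow_mul]
      norm_num

theorem lintegral_rpow_Ioo_ne_top {p : ℝ} (hp : -1 < p) :
    ∫⁻ t in Ioo (0 : ℝ) 1, ENNReal.ofReal (t ^ p) ≠ ⊤ := by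
  have h : IntegrableOn (fun t : ℝ => t ^ p) (Ioo 0 1) :=
    ((intervalIntegral.intervalIntegrable_rpow' hp (a := 0) (b := 1)).1).mono_set Ioo_subset_Ioc_self
  exact h.lintegral_lt_top.ne

theorem lintegral_rpow_Ioo_ne_zero (p : ℝ) :
    ∫⁻ t in Ioo (0 : ℝ) 1, ENNReal.ofReal (t ^ p) ≠ 0 := by
  rw [Ne, lintegral_eq_zero_iff (by fun_prop)]
  intro h
  have h2 : ∀ᵐ t ∂(volume.restrict (Ioo (0 : ℝ) 1)), False := by
    filter_upwards [h, ae_restrict_mem measurableSet_Ioo] with t ht ht'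
    simp only [Pi.zero_apply, ENNReal.ofReal_eq_zero] at ht
    exact absurd ht (not_le.2 (Real.rpow_pos_of_pos ht'.1 _))
  rw [ae_iff] at h2
  simp at h2

/-- The open upper half of the unit ball. -/
def halfBall (N : ℕ) : Set (Ambient N) := {P | 0 < height P ∧ ‖P‖ < 1}

theorem measurableSet_halfBall (N : ℕ) : MeasurableSet (halfBall N) :=
  (measurableSet_lt measurable_const measurable_height).inter
    (measurableSet_lt measurable_norm measurable_const)

/-- Polar coordinates in the half-ball, for the product of `y^a` and a homogeneous function. -/
theorem lintegral_halfBall_homogeneous (s k : ℝ) {g : Ambient N → ℝ≥0∞} (hg : Measurable g) :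
    ∫⁻ P, (halfBall N).indicator (fun P => ENNReal.ofReal (height P ^ (1 - 2 * s)) *
        (ENNReal.ofReal (‖P‖ ^ k) * g (‖P‖⁻¹ • P))) P =
      (∫⁻ r in Ioo (0 : ℝ) 1, ENNReal.ofReal (r ^ (N + (1 - 2 * s) + k))) *
        ∫⁻ X : USphere N, g X ∂(weightedSurf N s) := by
  rw [lintegral_polar_upper (Measurable.indicator (by fun_prop) (measurableSet_halfBall N))
    (fun P hP => indicator_of_notMem (fun h => absurd h.1 (not_lt.2 hP)) _),
    lintegral_weightedSurf s (f := fun X : USphere N => g X) (by fun_prop),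
    ← lintegral_const_mul _ (by fun_prop)]
  refine lintegral_congr_ae ?_
  filter_upwards [ae_height_pos N] with X hX
  rw [← lintegral_mul_const _ (by fun_prop), ← lintegral_indicator measurableSet_Ioi,
    ← lintegral_indicator measurableSet_Ioo]
  refine lintegral_congr fun r => ?_
  by_cases hr : r ∈ Ioo (0 : ℝ) 1
  · have hr0 : 0 < r := hr.1
    have hmem : r • (X : Ambient N) ∈ halfBall N := by
      refine ⟨by rw [height_smul]; positivity, ?_⟩
      rw [norm_smul, norm_eq_of_mem_sphere, mul_one, Real.norm_of_nonneg hr0.le]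
      exact hr.2
    rw [indicator_of_mem hr, indicator_of_mem (mem_Ioi.2 hr0), indicator_of_mem hmem, height_smul,
      norm_smul, norm_eq_of_mem_sphere, mul_one, Real.norm_of_nonneg hr0.le, smul_smul,
      inv_mul_cancel₀ hr0.ne', one_smul, Real.mul_rpow hr0.le hX.le,
      ENNReal.ofReal_mul (by positivity), Real.rpow_add hr0, Real.rpow_add hr0, Real.rpow_natCast,
      ENNReal.ofReal_mul (by positivity), ENNReal.ofReal_mul (by positivity)]
    ring
  · rw [indicator_of_notMem hr]
    by_cases hr0 : r ∈ Ioi (0 : ℝ)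
    · rw [indicator_of_mem hr0, indicator_of_notMem, mul_zero]
      rintro ⟨-, h⟩
      rw [norm_smul, norm_eq_of_mem_sphere, mul_one, Real.norm_of_nonneg (le_of_lt hr0)] at h
      exact hr ⟨hr0, h⟩
    · rw [indicator_of_notMem hr0]

theorem lintegral_comp_add_smul {E : Type*} [NormedAddCommGroup E] [NormedSpace ℝ E]
    [MeasurableSpace E] [BorelSpace E] [FiniteDimensional ℝ E] (μ : Measure E) [μ.IsAddHaarMeasure]
    {f : E → ℝ≥0∞} (hf : Measurable f) (c : E) {r : ℝ} (hr : 0 < r) :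
    ∫⁻ x, f (c + r • x) ∂μ = ENNReal.ofReal ((r ^ Module.finrank ℝ E)⁻¹) * ∫⁻ x, f x ∂μ := by
  have h1 := lintegral_map (μ := μ) (f := fun x => f (c + x)) (g := fun x : E => r • x)
    (by fun_prop) (by fun_prop)
  rw [← h1, Measure.map_addHaar_smul μ hr.ne', lintegral_smul_measure,
    lintegral_add_left_eq_self f c, abs_of_pos (by positivity), smul_eq_mul]

/-- The increment of the degree-zero homogeneous extension of `w` along a segment starting at a
boundary point; the factor `2` bounds the length of the segment. -/
theorem enorm_sub_le_lintegral_tangGrad {w : Ambient N → ℝ} (hw : ContDiff ℝ ∞ w)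
    {Z P : Ambient N} (hZ0 : Z ≠ 0) (hZh : height Z = 0) (hZ : ‖Z‖ < 1) (hP : P ∈ halfBall N) :
    ‖w (‖P‖⁻¹ • P) - w (‖Z‖⁻¹ • Z)‖ₑ ≤ ∫⁻ t in Ioo (0 : ℝ) 1,
      ENNReal.ofReal (2 * (‖(1 - t) • Z + t • P‖⁻¹ *
        ‖tangGrad w (‖(1 - t) • Z + t • P‖⁻¹ • ((1 - t) • Z + t • P))‖)) := by
  set Q : ℝ → Ambient N := fun t => (1 - t) • Z + t • P with hQ
  -- The segment avoids the origin, where the extension is singular: its height is positive for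
  -- `t > 0`.
  have hQ0 : ∀ t ∈ Icc (0 : ℝ) 1, Q t ≠ 0 := by
    intro t ht h
    rcases ht.1.eq_or_lt with h0 | h0
    · simp [hQ, ← h0, hZ0] at h
    · have h1 : height (Q t) = t * height P := by
        have : height (Q t) = (1 - t) * height Z + t * height P := by simp [hQ, height]
        rw [this, hZh]; ring
      rw [h] at h1
      have h2 : 0 < t * height P := mul_pos h0 hP.1
      rw [← h1] at h2
      simp [height] at h2
  have hQd : ∀ t, HasDerivAt Q (P - Z) t := by
    intro t
    have := ((((hasDerivAt_id t).const_sub 1).smul_const Z).add ((hasDerivAt_id t).smul_const P))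
    refine this.congr_deriv ?_
    simp [sub_eq_neg_add]
  have hQc : ContDiff ℝ ∞ Q := by fun_prop
  have hcd : ContDiffOn ℝ 1 (fun t => w (‖Q t‖⁻¹ • Q t)) (Icc 0 1) := by
    intro t ht
    have h1 : ContDiffAt ℝ 1 (fun P : Ambient N => w (‖P‖⁻¹ • P)) (Q t) :=
      (hw.of_le (by simp)).contDiffAt.comp (Q t) (contDiffAt_normalize (hQ0 t ht))
    exact (h1.comp t (hQc.of_le (by simp)).contDiffAt).contDiffWithinAt
  have hmain := enorm_sub_le_lintegral_deriv_of_contDiffOn_Icc hcd zero_le_one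
  have hQ1 : Q 1 = P := by simp [hQ]
  have hQ00 : Q 0 = Z := by simp [hQ]
  simp only [hQ1, hQ00] at hmain
  refine hmain.trans ?_
  rw [setLIntegral_congr Ioo_ae_eq_Icc.symm]
  refine setLIntegral_mono_ae' measurableSet_Ioo (.of_forall fun t ht => ?_)
  have ht' : t ∈ Icc (0 : ℝ) 1 := Ioo_subset_Icc_self ht
  have hne := norm_ne_zero_iff.2 (hQ0 t ht')
  set n := ‖Q t‖⁻¹ • Q t with hn
  have hder : HasDerivAt (fun t => w (‖Q t‖⁻¹ • Q t))
      (‖Q t‖⁻¹ * inner ℝ (tangGrad w n) (P - Z)) t := by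
    have h1 : HasFDerivAt w (fderiv ℝ w n) n := (hw.differentiable (by simp) _).hasFDerivAt
    have h2 := HasFDerivAt.comp_hasDerivAt (l := w) t h1
      ((hasFDerivAt_normalize (hQ0 t ht')).comp_hasDerivAt t (hQd t))
    refine h2.congr_deriv ?_
    generalize P - Z = v
    simp only [← hn, smul_apply, sub_apply, ContinuousLinearMap.id_apply,
      ContinuousLinearMap.smulRight_apply, map_smul, map_sub, innerSL_apply_apply, tangGrad,
      inner_sub_left, inner_smul_left, smul_eq_mul, ← inner_gradient_left]
    simp only [conj_trivial, real_inner_comm]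
    ring
  rw [hder.deriv, ← ofReal_norm]
  refine ENNReal.ofReal_le_ofReal ?_
  have hPZ : ‖P - Z‖ ≤ 2 := (norm_sub_le _ _).trans (by linarith [hP.2])
  have hin : |inner ℝ (tangGrad w n) (P - Z)| ≤ ‖tangGrad w n‖ * 2 :=
    (abs_real_inner_le_norm _ _).trans (by gcongr)
  rw [norm_mul, norm_inv, norm_norm, Real.norm_eq_abs]
  calc ‖Q t‖⁻¹ * |inner ℝ (tangGrad w n) (P - Z)| ≤ ‖Q t‖⁻¹ * (‖tangGrad w n‖ * 2) := by gcongr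
    _ = _ := by ring

/-! ### Averages over segments -/

/-- Averages over the segments joining a point of a horizontal set `B` to a point above `B`: for
`t ≤ 1/2` one integrates first over the starting point, for `t ≥ 1/2` over the end point. -/
theorem lintegral_segment_le {E : Type*} [NormedAddCommGroup E] [NormedSpace ℝ E]
    [MeasurableSpace E] [BorelSpace E] [FiniteDimensional ℝ E] (μ : Measure E) [μ.IsAddHaarMeasure]
    (B : Set E) {f : E × ℝ → ℝ≥0∞} (hf : Measurable f) {t : ℝ}
    (ht : t ∈ Ioo (0 : ℝ) 1) :
    ∫⁻ z in B, (∫⁻ x in B, (∫⁻ y : ℝ, f ((1 - t) • z + t • x, t * y)) ∂μ) ∂μ ≤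
      ENNReal.ofReal (2 ^ Module.finrank ℝ E) * μ B * ENNReal.ofReal t⁻¹ *
        ∫⁻ x, (∫⁻ y : ℝ, f (x, y)) ∂μ := by
  obtain ⟨ht0, ht1⟩ := ht
  set F : E → ℝ≥0∞ := fun x => ∫⁻ y : ℝ, f (x, y) with hF
  have hFm : Measurable F := hf.lintegral_prod_right'
  have hy : ∀ x, ∫⁻ y : ℝ, f (x, t * y) = ENNReal.ofReal t⁻¹ * F x := by
    intro x
    have := lintegral_comp_add_smul (volume : Measure ℝ) (f := fun y => f (x, y))
      (by fun_prop) 0 ht0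
    simpa using this
  simp only [hy]
  have hsc : ∀ (r : ℝ), 1 / 2 ≤ r → ∀ c, ∫⁻ x in B, ENNReal.ofReal t⁻¹ * F (c + r • x) ∂μ ≤
      ENNReal.ofReal (2 ^ Module.finrank ℝ E) * ENNReal.ofReal t⁻¹ * ∫⁻ x, F x ∂μ := by
    intro r hr c
    have hr0 : 0 < r := by linarith
    rw [lintegral_const_mul _ (by fun_prop), mul_comm (ENNReal.ofReal (2 ^ _)), mul_assoc]
    gcongr
    refine (setLIntegral_le_lintegral _ _).trans ?_
    rw [lintegral_comp_add_smul μ hFm c hr0]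
    gcongr
    rw [← inv_pow]
    gcongr
    rw [inv_le_comm₀ hr0 two_pos]
    linarith
  rcases le_total (1 / 2) t with h | h
  · calc _ ≤ ∫⁻ z in B, ENNReal.ofReal (2 ^ Module.finrank ℝ E) * ENNReal.ofReal t⁻¹ *
          ∫⁻ x, F x ∂μ ∂μ := by
            gcongr with z
            exact hsc t h _
      _ = _ := by
        rw [lintegral_const, Measure.restrict_apply_univ]
        ring
  · rw [lintegral_lintegral_swap (by fun_prop)]
    calc _ ≤ ∫⁻ x in B, ENNReal.ofReal (2 ^ Module.finrank ℝ E) * ENNReal.ofReal t⁻¹ *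
          ∫⁻ x, F x ∂μ ∂μ := by
            gcongr with x
            simp only [add_comm _ (t • x)]
            exact hsc (1 - t) (by linarith) _
      _ = _ := by
        rw [lintegral_const, Measure.restrict_apply_univ]
        ring

/-- The open unit ball of the boundary hyperplane `ℝ^N`, for the Euclidean norm. -/
def flatBall (N : ℕ) : Set (Fin N → ℝ) := {z | ‖(point z 0 : Ambient N)‖ < 1}

theorem measurableSet_flatBall (N : ℕ) : MeasurableSet (flatBall N) :=
  measurableSet_lt (by fun_prop) measurable_const

theorem norm_point_zero_le (x : Fin N → ℝ) (y : ℝ) : ‖point x 0‖ ≤ ‖point x y‖ := by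
  rw [← sq_le_sq₀ (norm_nonneg _) (norm_nonneg _), norm_sq_point, norm_sq_point]
  nlinarith [sq_nonneg y]

theorem point_zero_ne_zero {z : Fin N → ℝ} (hz : z ≠ 0) : (point z 0 : Ambient N) ≠ 0 := by
  intro h
  refine hz (funext fun i => ?_)
  simpa using congrArg (fun X : Ambient N => X i.castSucc) h

theorem volume_flatBall_ne_top (N : ℕ) : volume (flatBall N) ≠ ⊤ := by
  refine ((measure_mono ?_).trans_lt (measure_closedBall_lt_top (x := (0 : Fin N → ℝ)) (r := 1))).ne
  intro z hz
  rw [mem_closedBall_zero_iff, pi_norm_le_iff_of_nonneg zero_le_one]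
  intro i
  have := PiLp.norm_apply_le (point z 0 : Ambient N) i.castSucc
  rw [point_castSucc] at this
  exact this.trans (le_of_lt hz)

theorem volume_flatBall_ne_zero (N : ℕ) : volume (flatBall N) ≠ 0 := by
  have hopen : IsOpen (flatBall N) := by
    refine isOpen_lt ?_ continuous_const
    exact (continuous_point.comp (continuous_id.prodMk continuous_const)).norm
  refine (hopen.measure_pos volume ⟨0, ?_⟩).ne'
  have : ‖(point 0 0 : Ambient N)‖ ^ 2 = 0 := by rw [norm_sq_point]; simp
  have h0 : ‖(point 0 0 : Ambient N)‖ = 0 := by simpa using this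
  change ‖(point 0 0 : Ambient N)‖ < 1
  rw [h0]; exact one_pos

/-- The constant of the trace inequality below. Its first factor comes from polar coordinates on
the left-hand side, the last one from polar coordinates for the energy of the homogeneous
extension; one power of `∫₀¹ t^{s-1} dt` comes from Cauchy–Schwarz, the other from the change of
variables. -/
def traceConst (N : ℕ) (s : ℝ) : ℝ≥0∞ :=
  (∫⁻ r in Ioo (0 : ℝ) 1, ENNReal.ofReal (r ^ (N + (1 - 2 * s) + 0)))⁻¹ *
    (4 * (∫⁻ t in Ioo (0 : ℝ) 1, ENNReal.ofReal (t ^ (s - 1))) ^ 2 *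
      (ENNReal.ofReal (2 ^ N) * volume (flatBall N)) *
      ∫⁻ r in Ioo (0 : ℝ) 1, ENNReal.ofReal (r ^ (N + (1 - 2 * s) + (-2))))

theorem traceConst_ne_top (hN : 2 ≤ N) {s : ℝ} (hs0 : 0 < s) (hs1 : s < 1) :
    traceConst N s ≠ ⊤ := by
  have hN' : (2 : ℝ) ≤ N := by exact_mod_cast hN
  have h1 := lintegral_rpow_Ioo_ne_top (p := s - 1) (by linarith)
  have h2 := lintegral_rpow_Ioo_ne_top (p := N + (1 - 2 * s) + (-2)) (by linarith)
  refine ENNReal.mul_ne_top (ENNReal.inv_ne_top.2 (lintegral_rpow_Ioo_ne_zero _)) ?_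
  refine ENNReal.mul_ne_top (ENNReal.mul_ne_top (ENNReal.mul_ne_top (by simp)
    (ENNReal.pow_ne_top h1)) (ENNReal.mul_ne_top (by simp) (volume_flatBall_ne_top N))) h2

/-! ### The trace inequality -/

/-- Tonelli's theorem, moving the innermost of four integrals to the front. -/
theorem lintegral_swap_inner {α β γ δ : Type*} [MeasurableSpace α] [MeasurableSpace β]
    [MeasurableSpace γ] [MeasurableSpace δ] {μ : Measure α} {ν : Measure β} {ρ : Measure γ}
    {τ : Measure δ} [SFinite μ] [SFinite ν] [SFinite ρ] [SFinite τ] {Φ : α → β → γ → δ → ℝ≥0∞}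
    (hΦ : Measurable fun q : α × β × γ × δ => Φ q.1 q.2.1 q.2.2.1 q.2.2.2) :
    ∫⁻ a, (∫⁻ b, (∫⁻ c, (∫⁻ d, Φ a b c d ∂τ) ∂ρ) ∂ν) ∂μ =
      ∫⁻ d, (∫⁻ a, (∫⁻ b, (∫⁻ c, Φ a b c d ∂ρ) ∂ν) ∂μ) ∂τ := by
  have h1 : ∀ a b, ∫⁻ c, (∫⁻ d, Φ a b c d ∂τ) ∂ρ = ∫⁻ d, (∫⁻ c, Φ a b c d ∂ρ) ∂τ := fun a b =>
    lintegral_lintegral_swap (hΦ.comp (f := fun q : γ × δ => (a, b, q.1, q.2))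
      (by fun_prop)).aemeasurable
  have m1 : Measurable fun q : α × β × δ => ∫⁻ c, Φ q.1 q.2.1 c q.2.2 ∂ρ :=
    Measurable.lintegral_prod_right' (f := fun q : (α × β × δ) × γ => Φ q.1.1 q.1.2.1 q.2 q.1.2.2)
      (hΦ.comp (f := fun q : (α × β × δ) × γ => (q.1.1, q.1.2.1, q.2, q.1.2.2)) (by fun_prop))
  have h2 : ∀ a, ∫⁻ b, (∫⁻ d, (∫⁻ c, Φ a b c d ∂ρ) ∂τ) ∂ν =
      ∫⁻ d, (∫⁻ b, (∫⁻ c, Φ a b c d ∂ρ) ∂ν) ∂τ := fun a =>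
    lintegral_lintegral_swap (m1.comp (f := fun q : β × δ => (a, q.1, q.2))
      (by fun_prop)).aemeasurable
  have m2 : Measurable fun q : α × δ => ∫⁻ b, (∫⁻ c, Φ q.1 b c q.2 ∂ρ) ∂ν :=
    Measurable.lintegral_prod_right' (f := fun q : (α × δ) × β => ∫⁻ c, Φ q.1.1 q.2 c q.1.2 ∂ρ)
      (m1.comp (f := fun q : (α × δ) × β => (q.1.1, q.2, q.1.2)) (by fun_prop))
  simp only [h1, h2]
  exact lintegral_lintegral_swap m2.aemeasurable

/-- The square length of the gradient of the extension of `w` homogeneous of degree zero. -/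
def extGradSq (w : Ambient N → ℝ) (P : Ambient N) : ℝ≥0∞ :=
  ENNReal.ofReal (‖P‖ ^ (-2 : ℝ)) * ENNReal.ofReal (‖tangGrad w (‖P‖⁻¹ • P)‖ ^ 2)

/-- The weighted energy density of the extension of `w` homogeneous of degree zero, in the
half-ball. -/
def energyDensity (s : ℝ) (w : Ambient N → ℝ) : Ambient N → ℝ≥0∞ :=
  (halfBall N).indicator fun P => ENNReal.ofReal (height P ^ (1 - 2 * s)) * extGradSq w P

theorem measurable_tangGrad {w : Ambient N → ℝ} (hw : ContDiff ℝ ∞ w) : Measurable (tangGrad w) :=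
  (continuous_tangGrad hw).measurable

theorem measurable_extGradSq {w : Ambient N → ℝ} (hw : ContDiff ℝ ∞ w) :
    Measurable (extGradSq w) := by
  have := measurable_tangGrad hw
  unfold extGradSq
  fun_prop

theorem measurable_energyDensity (s : ℝ) {w : Ambient N → ℝ} (hw : ContDiff ℝ ∞ w) :
    Measurable (energyDensity s w) := by
  have := measurable_extGradSq hw
  exact Measurable.indicator (by fun_prop) (measurableSet_halfBall N)

theorem lintegral_energyDensity (s : ℝ) {w : Ambient N → ℝ} (hw : ContDiff ℝ ∞ w) :
    ∫⁻ x : Fin N → ℝ, ∫⁻ y : ℝ, energyDensity s w (point x y) =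
      (∫⁻ r in Ioo (0 : ℝ) 1, ENNReal.ofReal (r ^ (N + (1 - 2 * s) + (-2)))) *
        ∫⁻ X : USphere N, ENNReal.ofReal (‖tangGrad w X‖ ^ 2) ∂(weightedSurf N s) := by
  have := measurable_tangGrad hw
  rw [← lintegral_slice (measurable_energyDensity s hw), ← lintegral_halfBall_homogeneous s (-2)
    (g := fun P => ENNReal.ofReal (‖tangGrad w P‖ ^ 2)) (by fun_prop)]
  rfl

/-- The weighted Cauchy–Schwarz inequality along the segment from the point `(z, 0)` of the
boundary to the point `(x, y)` of the half-ball. -/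
theorem segment_estimate {s : ℝ} {w : Ambient N → ℝ} (hw : ContDiff ℝ ∞ w) {z x : Fin N → ℝ}
    {y : ℝ} (hz : z ∈ flatBall N) (hz0 : z ≠ 0) (hP : point x y ∈ halfBall N) :
    ENNReal.ofReal (y ^ (1 - 2 * s)) *
      ENNReal.ofReal ((w (‖point x y‖⁻¹ • point x y) - w (‖point z 0‖⁻¹ • point z 0)) ^ 2) ≤
    4 * (∫⁻ t in Ioo (0 : ℝ) 1, ENNReal.ofReal (t ^ (s - 1))) *
      ∫⁻ t in Ioo (0 : ℝ) 1, ENNReal.ofReal (t ^ s) *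
        energyDensity s w (point ((1 - t) • z + t • x) (t * y)) := by
  have hy : 0 < y := by simpa using hP.1
  have hmg := measurable_tangGrad hw
  have hme := measurable_energyDensity s hw
  set Z : Ambient N := point z 0 with hZ
  set P : Ambient N := point x y with hPdef
  have hZ0 : Z ≠ 0 := point_zero_ne_zero hz0
  have hQ : ∀ t : ℝ, point ((1 - t) • z + t • x) (t * y) = (1 - t) • Z + t • P := by
    intro t
    rw [hZ, hPdef, ← point_add_smul, mul_zero, zero_add]
  have h1 := enorm_sub_le_lintegral_tangGrad hw hZ0 (by simp [hZ]) hz hP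
  set D : Ambient N → ℝ := fun Q => ‖Q‖⁻¹ * ‖tangGrad w (‖Q‖⁻¹ • Q)‖ with hD
  have hDm : Measurable D := by fun_prop
  have hDsq : ∀ Q, ENNReal.ofReal (2 * D Q) ^ 2 = 4 * extGradSq w Q := by
    intro Q
    rw [extGradSq, ← ENNReal.ofReal_pow (by positivity), ← ENNReal.ofReal_mul (by positivity),
      Real.rpow_neg (norm_nonneg _), Real.rpow_two,
      show (2 * D Q) ^ 2 = 4 * ((‖Q‖ ^ 2)⁻¹ * ‖tangGrad w (‖Q‖⁻¹ • Q)‖ ^ 2) by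
        rw [hD, ← inv_pow]; ring, ENNReal.ofReal_mul (by norm_num)]
    norm_num
  have h2 : ENNReal.ofReal ((w (‖P‖⁻¹ • P) - w (‖Z‖⁻¹ • Z)) ^ 2) ≤
      (∫⁻ t in Ioo (0 : ℝ) 1, ENNReal.ofReal (2 * D ((1 - t) • Z + t • P))) ^ 2 := by
    rw [← sq_abs, ENNReal.ofReal_pow (abs_nonneg _), ← Real.norm_eq_abs, ofReal_norm]
    gcongr
  have h3 := lintegral_sq_le_mul (μ := volume.restrict (Ioo (0 : ℝ) 1))
    (ρ := fun t => ENNReal.ofReal (t ^ (1 - s)))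
    (g := fun t => ENNReal.ofReal (2 * D ((1 - t) • Z + t • P))) (by fun_prop) (by fun_prop) (by
      filter_upwards [ae_restrict_mem measurableSet_Ioo] with t ht
      exact ⟨(ENNReal.ofReal_pos.2 (Real.rpow_pos_of_pos ht.1 _)).ne', ENNReal.ofReal_ne_top⟩)
  have h4 : ∫⁻ t in Ioo (0 : ℝ) 1, (ENNReal.ofReal (t ^ (1 - s)))⁻¹ =
      ∫⁻ t in Ioo (0 : ℝ) 1, ENNReal.ofReal (t ^ (s - 1)) := by
    refine setLIntegral_congr_fun measurableSet_Ioo fun t ht => ?_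
    rw [← ENNReal.ofReal_inv_of_pos (Real.rpow_pos_of_pos ht.1 _), ← Real.rpow_neg ht.1.le, neg_sub]
  have h5 : ENNReal.ofReal (y ^ (1 - 2 * s)) * ∫⁻ t in Ioo (0 : ℝ) 1,
        ENNReal.ofReal (t ^ (1 - s)) * ENNReal.ofReal (2 * D ((1 - t) • Z + t • P)) ^ 2 =
      4 * ∫⁻ t in Ioo (0 : ℝ) 1, ENNReal.ofReal (t ^ s) *
        energyDensity s w (point ((1 - t) • z + t • x) (t * y)) := by
    rw [← lintegral_const_mul _ (by fun_prop), ← lintegral_const_mul _ (by fun_prop)]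
    refine setLIntegral_congr_fun measurableSet_Ioo fun t ht => ?_
    have ht0 : 0 < t := ht.1
    have ht1 : 0 < 1 - t := by linarith [ht.2]
    have hmem : (1 - t) • Z + t • P ∈ halfBall N := by
      refine ⟨by rw [← hQ, height_point]; positivity, ?_⟩
      calc ‖(1 - t) • Z + t • P‖ ≤ (1 - t) * ‖Z‖ + t * ‖P‖ := by
            refine (norm_add_le _ _).trans_eq ?_
            rw [norm_smul, norm_smul, Real.norm_of_nonneg ht1.le, Real.norm_of_nonneg ht0.le]
        _ < 1 := by
            have e1 : ‖Z‖ < 1 := hz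
            have e2 : ‖P‖ < 1 := hP.2
            nlinarith
    have hh : height ((1 - t) • Z + t • P) = t * y := by rw [← hQ, height_point]
    beta_reduce
    rw [hDsq, hQ, energyDensity, indicator_of_mem hmem, hh, Real.mul_rpow ht0.le hy.le,
      ENNReal.ofReal_mul (by positivity)]
    have e3 : ENNReal.ofReal (t ^ (1 - s)) =
        ENNReal.ofReal (t ^ s) * ENNReal.ofReal (t ^ (1 - 2 * s)) := by
      rw [← ENNReal.ofReal_mul (by positivity), ← Real.rpow_add ht0]
      congr 2
      ring
    rw [e3]
    ring
  calc _ ≤ ENNReal.ofReal (y ^ (1 - 2 * s)) * ((∫⁻ t in Ioo (0 : ℝ) 1,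
        ENNReal.ofReal (t ^ (s - 1))) * ∫⁻ t in Ioo (0 : ℝ) 1, ENNReal.ofReal (t ^ (1 - s)) *
          ENNReal.ofReal (2 * D ((1 - t) • Z + t • P)) ^ 2) := by
        rw [← h4]
        gcongr
        exact h2.trans h3
    _ = _ := by
        rw [mul_left_comm, h5]
        ring

/-- A combined Poincaré and trace inequality: the trace of `w` at a boundary point is compared
with the values of `w` on the half-sphere, on average over the boundary points. -/
theorem lintegral_trace_le (hN : 2 ≤ N) {s : ℝ} (hs0 : 0 < s) (hs1 : s < 1)
    {w : Ambient N → ℝ} (hw : ContDiff ℝ ∞ w) :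
    ∫⁻ z in flatBall N, (∫⁻ X : USphere N,
        ENNReal.ofReal ((w X - w (‖point z 0‖⁻¹ • point z 0)) ^ 2) ∂(weightedSurf N s)) ≤
      traceConst N s *
        ∫⁻ X : USphere N, ENNReal.ofReal (‖tangGrad w X‖ ^ 2) ∂(weightedSurf N s) := by
  have hN' : (2 : ℝ) ≤ N := by exact_mod_cast hN
  have hwm : Measurable w := hw.continuous.measurable
  have hme := measurable_energyDensity s hw
  set κ := ∫⁻ r in Ioo (0 : ℝ) 1, ENNReal.ofReal (r ^ (N + (1 - 2 * s) + 0)) with hκ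
  set K := ∫⁻ t in Ioo (0 : ℝ) 1, ENNReal.ofReal (t ^ (s - 1)) with hK
  set I := ∫⁻ X : USphere N, ENNReal.ofReal (‖tangGrad w X‖ ^ 2) ∂(weightedSurf N s) with hI
  have hκ0 : κ ≠ 0 := lintegral_rpow_Ioo_ne_zero _
  have hκt : κ ≠ ⊤ := lintegral_rpow_Ioo_ne_top (by linarith)
  have hz : ∀ᵐ z ∂(volume.restrict (flatBall N)), κ * (∫⁻ X : USphere N,
      ENNReal.ofReal ((w X - w (‖point z 0‖⁻¹ • point z 0)) ^ 2) ∂(weightedSurf N s)) ≤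
      ∫⁻ x in flatBall N, ∫⁻ y : ℝ, ∫⁻ t in Ioo (0 : ℝ) 1, 4 * K * (ENNReal.ofReal (t ^ s) *
        energyDensity s w (point ((1 - t) • z + t • x) (t * y))) := by
    have hne : ∀ᵐ z : Fin N → ℝ, z ≠ 0 := by
      have : Nonempty (Fin N) := ⟨⟨0, by omega⟩⟩
      exact Measure.ae_ne volume 0
    filter_upwards [ae_restrict_mem (measurableSet_flatBall N), ae_restrict_of_ae hne] with z hz hz0
    have hpol := lintegral_halfBall_homogeneous (N := N) s 0
      (g := fun P => ENNReal.ofReal ((w P - w (‖point z 0‖⁻¹ • point z 0)) ^ 2)) (by fun_prop)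
    rw [← hκ] at hpol
    rw [← hpol, lintegral_slice (Measurable.indicator (by fun_prop) (measurableSet_halfBall N)),
      ← lintegral_indicator (measurableSet_flatBall N)]
    refine lintegral_mono fun x => ?_
    by_cases hx : x ∈ flatBall N
    · rw [indicator_of_mem hx]
      refine lintegral_mono fun y => ?_
      by_cases hP : point x y ∈ halfBall N
      · rw [indicator_of_mem hP, height_point, Real.rpow_zero, ENNReal.ofReal_one, one_mul,
          lintegral_const_mul _ (by fun_prop)]
        exact segment_estimate hw hz hz0 hP
      · rw [indicator_of_notMem hP]
        exact zero_le
    · rw [indicator_of_notMem hx]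
      refine le_of_eq ((lintegral_congr fun y => ?_).trans lintegral_zero)
      refine indicator_of_notMem (fun hP => hx ?_) _
      exact (norm_point_zero_le x y).trans_lt hP.2
  have hmain : κ * ∫⁻ z in flatBall N, (∫⁻ X : USphere N,
        ENNReal.ofReal ((w X - w (‖point z 0‖⁻¹ • point z 0)) ^ 2) ∂(weightedSurf N s)) ≤
      4 * K ^ 2 * (ENNReal.ofReal (2 ^ N) * volume (flatBall N)) *
        (∫⁻ r in Ioo (0 : ℝ) 1, ENNReal.ofReal (r ^ (N + (1 - 2 * s) + (-2)))) * I := by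
    rw [← lintegral_const_mul' _ _ hκt]
    refine (lintegral_mono_ae hz).trans ?_
    rw [lintegral_swap_inner (by fun_prop)]
    calc _ ≤ ∫⁻ t in Ioo (0 : ℝ) 1, ENNReal.ofReal (t ^ (s - 1)) *
          (4 * K * (ENNReal.ofReal (2 ^ N) * volume (flatBall N)) *
            ((∫⁻ r in Ioo (0 : ℝ) 1, ENNReal.ofReal (r ^ (N + (1 - 2 * s) + (-2)))) * I)) := by
          refine setLIntegral_mono_ae' measurableSet_Ioo (.of_forall fun t ht => ?_)
          have hseg := lintegral_segment_le (volume : Measure (Fin N → ℝ)) (flatBall N)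
            (f := fun q => energyDensity s w (point q.1 q.2)) (by fun_prop) ht
          rw [lintegral_energyDensity s hw, ← hI, Module.finrank_fin_fun] at hseg
          have hc : ∀ (c : ℝ≥0∞) (z : Fin N → ℝ), ∫⁻ x in flatBall N, ∫⁻ y : ℝ,
              c * energyDensity s w (point ((1 - t) • z + t • x) (t * y)) =
              c * ∫⁻ x in flatBall N, ∫⁻ y : ℝ,
                energyDensity s w (point ((1 - t) • z + t • x) (t * y)) := by
            intro c z
            rw [← lintegral_const_mul c (by fun_prop)]
            refine lintegral_congr fun x => ?_
            rw [← lintegral_const_mul c (by fun_prop)]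
          simp only [← mul_assoc (4 * K), hc]
          rw [lintegral_const_mul _ (by fun_prop), mul_assoc (4 * K)]
          have ht1 : ENNReal.ofReal (t ^ (s - 1)) = ENNReal.ofReal (t ^ s) * ENNReal.ofReal t⁻¹ := by
            rw [← ENNReal.ofReal_mul (Real.rpow_nonneg ht.1.le _), Real.rpow_sub_one ht.1.ne',
              div_eq_mul_inv]
          calc _ ≤ 4 * K * (ENNReal.ofReal (t ^ s) * (ENNReal.ofReal (2 ^ N) *
                volume (flatBall N) * ENNReal.ofReal t⁻¹ *
                ((∫⁻ r in Ioo (0 : ℝ) 1, ENNReal.ofReal (r ^ (N + (1 - 2 * s) + (-2)))) * I))) := by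
                gcongr
            _ = _ := by rw [ht1]; ring
      _ = _ := by
          rw [lintegral_mul_const _ (by fun_prop), ← hK]
          ring
  calc _ = κ⁻¹ * (κ * ∫⁻ z in flatBall N, (∫⁻ X : USphere N,
        ENNReal.ofReal ((w X - w (‖point z 0‖⁻¹ • point z 0)) ^ 2) ∂(weightedSurf N s))) := by
        rw [← mul_assoc, ENNReal.inv_mul_cancel hκ0 hκt, one_mul]
    _ ≤ κ⁻¹ * (4 * K ^ 2 * (ENNReal.ofReal (2 ^ N) * volume (flatBall N)) *
        (∫⁻ r in Ioo (0 : ℝ) 1, ENNReal.ofReal (r ^ (N + (1 - 2 * s) + (-2)))) * I) := by gcongr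
    _ = _ := by
        rw [traceConst]
        ring

/-! ### Lower bound for pairs of disjoint sets -/

theorem lintegral_ofReal_norm_sq {α F : Type*} [MeasurableSpace α] [NormedAddCommGroup F]
    (μ : Measure α) (f : α → F) :
    ∫⁻ x, ENNReal.ofReal (‖f x‖ ^ 2) ∂μ = eLpNorm f 2 μ ^ 2 := by
  rw [eLpNorm_eq_lintegral_rpow_enorm_toReal two_ne_zero ENNReal.ofNat_ne_top,
    ← ENNReal.rpow_natCast, ← ENNReal.rpow_mul]
  simp [ENNReal.ofReal_pow]

theorem integral_norm_sq_eq_toReal {α F : Type*} [MeasurableSpace α] [NormedAddCommGroup F]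
    {μ : Measure α} {f : α → F} (hf : MemLp f 2 μ) :
    ∫ x, ‖f x‖ ^ 2 ∂μ = (eLpNorm f 2 μ ^ 2).toReal := by
  rw [← lintegral_ofReal_norm_sq]
  exact integral_eq_lintegral_of_nonneg_ae (.of_forall fun x => by positivity) (hf.1.norm.pow 2)

theorem tendsto_eLpNorm_of_tendsto_sub {α F : Type*} [MeasurableSpace α] [NormedAddCommGroup F]
    {μ : Measure α} {f : ℕ → α → F} {g : α → F} (hf : ∀ n, AEStronglyMeasurable (f n) μ)
    (hg : MemLp g 2 μ) (h : Tendsto (fun n => eLpNorm (fun x => f n x - g x) 2 μ) atTop (𝓝 0)) :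
    Tendsto (fun n => eLpNorm (f n) 2 μ) atTop (𝓝 (eLpNorm g 2 μ)) := by
  have hlow : Tendsto (fun n => eLpNorm g 2 μ - eLpNorm (fun x => f n x - g x) 2 μ) atTop
      (𝓝 (eLpNorm g 2 μ)) := by
    simpa using ENNReal.Tendsto.sub tendsto_const_nhds h (Or.inl hg.2.ne)
  have hupp : Tendsto (fun n => eLpNorm g 2 μ + eLpNorm (fun x => f n x - g x) 2 μ) atTop
      (𝓝 (eLpNorm g 2 μ)) := by
    simpa using tendsto_const_nhds.add h
  refine tendsto_of_tendsto_of_tendsto_of_le_of_le hlow hupp (fun n => ?_) fun n => ?_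
  · rw [tsub_le_iff_right]
    have := eLpNorm_sub_le (p := 2) (hf n) ((hf n).sub hg.1) (by norm_num)
    simpa [Pi.sub_def] using this
  · have := eLpNorm_add_le (p := 2) hg.1 ((hf n).sub hg.1) (by norm_num)
    simpa [Pi.sub_def, Pi.add_def] using this

/-- At each boundary point one of the two functions vanishes, so that its mean square deviation
from the value at that point is its full square norm. -/
theorem volume_mul_le_of_mul_eq_zero (hN : 2 ≤ N) {s : ℝ} (hs0 : 0 < s) (hs1 : s < 1)
    {w₁ w₂ : Ambient N → ℝ} (hw₁ : ContDiff ℝ ∞ w₁) (hw₂ : ContDiff ℝ ∞ w₂)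
    (h : ∀ X : equator N, w₁ X = 0 ∨ w₂ X = 0) :
    volume (flatBall N) * ((∫⁻ X : USphere N, ENNReal.ofReal (‖w₁ X‖ ^ 2) ∂(weightedSurf N s)) *
        ∫⁻ X : USphere N, ENNReal.ofReal (‖w₂ X‖ ^ 2) ∂(weightedSurf N s)) ≤
      traceConst N s * ((∫⁻ X : USphere N, ENNReal.ofReal (‖w₂ X‖ ^ 2) ∂(weightedSurf N s)) *
          (∫⁻ X : USphere N, ENNReal.ofReal (‖tangGrad w₁ X‖ ^ 2) ∂(weightedSurf N s)) +
        (∫⁻ X : USphere N, ENNReal.ofReal (‖w₁ X‖ ^ 2) ∂(weightedSurf N s)) *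
          ∫⁻ X : USphere N, ENNReal.ofReal (‖tangGrad w₂ X‖ ^ 2) ∂(weightedSurf N s)) := by
  have hfin := isFiniteMeasure_weightedSurf N hs1
  have t₁ := lintegral_trace_le hN hs0 hs1 hw₁
  have t₂ := lintegral_trace_le hN hs0 hs1 hw₂
  have m₁ : Measurable w₁ := hw₁.continuous.measurable
  have m₂ : Measurable w₂ := hw₂.continuous.measurable
  set a₁ := ∫⁻ X : USphere N, ENNReal.ofReal (‖w₁ X‖ ^ 2) ∂(weightedSurf N s) with ha₁
  set a₂ := ∫⁻ X : USphere N, ENNReal.ofReal (‖w₂ X‖ ^ 2) ∂(weightedSurf N s) with ha₂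
  set F₁ : (Fin N → ℝ) → ℝ≥0∞ := fun z => ∫⁻ X : USphere N,
    ENNReal.ofReal ((w₁ X - w₁ (‖point z 0‖⁻¹ • point z 0)) ^ 2) ∂(weightedSurf N s) with hF₁
  set F₂ : (Fin N → ℝ) → ℝ≥0∞ := fun z => ∫⁻ X : USphere N,
    ENNReal.ofReal ((w₂ X - w₂ (‖point z 0‖⁻¹ • point z 0)) ^ 2) ∂(weightedSurf N s) with hF₂
  have mF₁ : Measurable F₁ := Measurable.lintegral_prod_right'
    (f := fun q : (Fin N → ℝ) × USphere N =>
      ENNReal.ofReal ((w₁ q.2 - w₁ (‖point q.1 0‖⁻¹ • point q.1 0)) ^ 2)) (by fun_prop)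
  have mF₂ : Measurable F₂ := Measurable.lintegral_prod_right'
    (f := fun q : (Fin N → ℝ) × USphere N =>
      ENNReal.ofReal ((w₂ q.2 - w₂ (‖point q.1 0‖⁻¹ • point q.1 0)) ^ 2)) (by fun_prop)
  have hne : ∀ᵐ z : Fin N → ℝ, z ≠ 0 := by
    have : Nonempty (Fin N) := ⟨⟨0, by omega⟩⟩
    exact Measure.ae_ne volume 0
  have hpt : ∀ z : Fin N → ℝ, z ≠ 0 → a₁ * a₂ ≤ a₂ * F₁ z + a₁ * F₂ z := by
    intro z hz
    have hZ0 := point_zero_ne_zero hz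
    have hZ : ‖(point z 0 : Ambient N)‖⁻¹ • point z 0 ∈ equator N := by
      refine ⟨?_, by rw [height_smul, height_point, mul_zero]⟩
      rw [norm_smul, norm_inv, norm_norm, inv_mul_cancel₀ (norm_ne_zero_iff.2 hZ0)]
    rcases h ⟨_, hZ⟩ with h0 | h0
    · have : F₁ z = a₁ := by
        simp only [hF₁, ha₁]
        refine lintegral_congr fun X => ?_
        rw [h0, sub_zero, Real.norm_eq_abs, sq_abs]
      rw [this, mul_comm a₁ a₂]
      exact le_self_add
    · have : F₂ z = a₂ := by
        simp only [hF₂, ha₂]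
        refine lintegral_congr fun X => ?_
        rw [h0, sub_zero, Real.norm_eq_abs, sq_abs]
      rw [this]
      exact le_add_self
  calc volume (flatBall N) * (a₁ * a₂) = ∫⁻ z in flatBall N, a₁ * a₂ := by
        rw [lintegral_const, Measure.restrict_apply_univ, mul_comm]
    _ ≤ ∫⁻ z in flatBall N, (a₂ * F₁ z + a₁ * F₂ z) := by
        refine lintegral_mono_ae ?_
        filter_upwards [ae_restrict_of_ae hne] with z hz using hpt z hz
    _ = a₂ * (∫⁻ z in flatBall N, F₁ z) + a₁ * ∫⁻ z in flatBall N, F₂ z := by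
        rw [lintegral_add_left (by fun_prop), lintegral_const_mul _ mF₁, lintegral_const_mul _ mF₂]
    _ ≤ _ := by
        refine (add_le_add (mul_le_mul_right t₁ a₂) (mul_le_mul_right t₂ a₁)).trans_eq ?_
        ring

/-- The lower bound for the sum of the Rayleigh quotients of two functions with disjoint traces.
The summand `1` only keeps the denominator positive. -/
def gapConst (N : ℕ) (s : ℝ) : ℝ := (volume (flatBall N)).toReal / ((traceConst N s).toReal + 1)

theorem gapConst_pos (N : ℕ) (s : ℝ) : 0 < gapConst N s :=
  div_pos (ENNReal.toReal_pos (volume_flatBall_ne_zero N) (volume_flatBall_ne_top N)) (by positivity)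

/-- The inequality for smooth functions passes to limits in `H^{1;a}`. -/
theorem gapConst_le_add_rayleigh (hN : 2 ≤ N) {s : ℝ} (hs0 : 0 < s) (hs1 : s < 1)
    {Ω₁ Ω₂ : Set (equator N)} (hΩ : Ω₁ ∩ Ω₂ = ∅) {u₁ u₂ : USphere N → ℝ}
    {G₁ G₂ : USphere N → Ambient N} (h₁ : MemH1 s u₁ G₁) (h₂ : MemH1 s u₂ G₂)
    (v₁ : VanishesOff s Ω₁ u₁ G₁) (v₂ : VanishesOff s Ω₂ u₂ G₂)
    (n₁ : ∫ X, u₁ X ^ 2 ∂(weightedSurf N s) ≠ 0) (n₂ : ∫ X, u₂ X ^ 2 ∂(weightedSurf N s) ≠ 0) :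
    gapConst N s ≤
      (∫ X, ‖G₁ X‖ ^ 2 ∂(weightedSurf N s)) / (∫ X, u₁ X ^ 2 ∂(weightedSurf N s)) +
        (∫ X, ‖G₂ X‖ ^ 2 ∂(weightedSurf N s)) / ∫ X, u₂ X ^ 2 ∂(weightedSurf N s) := by
  obtain ⟨w₁, hw₁, z₁, lu₁, lG₁⟩ := v₁
  obtain ⟨w₂, hw₂, z₂, lu₂, lG₂⟩ := v₂
  have mw : ∀ w : Ambient N → ℝ, ContDiff ℝ ∞ w →
      AEStronglyMeasurable (fun X : USphere N => w X) (weightedSurf N s) := fun w hw =>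
    (hw.continuous.comp continuous_subtype_val).aestronglyMeasurable
  have mG : ∀ w : Ambient N → ℝ, ContDiff ℝ ∞ w →
      AEStronglyMeasurable (fun X : USphere N => tangGrad w X) (weightedSurf N s) := fun w hw =>
    ((continuous_tangGrad hw).comp continuous_subtype_val).aestronglyMeasurable
  have eu₁ := tendsto_eLpNorm_of_tendsto_sub (fun n => mw _ (hw₁ n)) h₁.memLp lu₁
  have eu₂ := tendsto_eLpNorm_of_tendsto_sub (fun n => mw _ (hw₂ n)) h₂.memLp lu₂
  have eG₁ := tendsto_eLpNorm_of_tendsto_sub (fun n => mG _ (hw₁ n)) h₁.memLp_grad lG₁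
  have eG₂ := tendsto_eLpNorm_of_tendsto_sub (fun n => mG _ (hw₂ n)) h₂.memLp_grad lG₂
  have hineq := fun n => volume_mul_le_of_mul_eq_zero hN hs0 hs1 (hw₁ n) (hw₂ n) fun X => by
    by_cases hX : X ∈ Ω₁
    · exact Or.inr (z₂ n X fun hX2 => (hΩ ▸ (⟨hX, hX2⟩ : X ∈ Ω₁ ∩ Ω₂) : X ∈ (∅ : Set (equator N))))
    · exact Or.inl (z₁ n X hX)
  simp only [lintegral_ofReal_norm_sq (weightedSurf N s) (fun X : USphere N => w₁ _ X),
    lintegral_ofReal_norm_sq (weightedSurf N s) (fun X : USphere N => w₂ _ X),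
    lintegral_ofReal_norm_sq (weightedSurf N s) (fun X : USphere N => tangGrad (w₁ _) X),
    lintegral_ofReal_norm_sq (weightedSurf N s) (fun X : USphere N => tangGrad (w₂ _) X)] at hineq
  have i₁ := integral_norm_sq_eq_toReal h₁.memLp
  have i₂ := integral_norm_sq_eq_toReal h₂.memLp
  have j₁ := integral_norm_sq_eq_toReal h₁.memLp_grad
  have j₂ := integral_norm_sq_eq_toReal h₂.memLp_grad
  simp only [Real.norm_eq_abs, sq_abs] at i₁ i₂
  have fu₁ : eLpNorm u₁ 2 (weightedSurf N s) ^ 2 ≠ ⊤ := ENNReal.pow_ne_top h₁.memLp.2.ne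
  have fu₂ : eLpNorm u₂ 2 (weightedSurf N s) ^ 2 ≠ ⊤ := ENNReal.pow_ne_top h₂.memLp.2.ne
  have fG₁ : eLpNorm G₁ 2 (weightedSurf N s) ^ 2 ≠ ⊤ := ENNReal.pow_ne_top h₁.memLp_grad.2.ne
  have fG₂ : eLpNorm G₂ 2 (weightedSurf N s) ^ 2 ≠ ⊤ := ENNReal.pow_ne_top h₂.memLp_grad.2.ne
  have hC := traceConst_ne_top hN hs0 hs1
  have hV := volume_flatBall_ne_top N
  have sq : ∀ {f : ℕ → ℝ≥0∞} {a : ℝ≥0∞}, Tendsto f atTop (𝓝 a) →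
      Tendsto (fun n => f n ^ 2) atTop (𝓝 (a ^ 2)) := fun h =>
    ((ENNReal.continuous_pow 2).tendsto _).comp h
  have hlim := le_of_tendsto_of_tendsto'
    (ENNReal.Tendsto.const_mul (a := volume (flatBall N))
      (ENNReal.Tendsto.mul (sq eu₁) (Or.inr fu₂) (sq eu₂) (Or.inr fu₁)) (Or.inr hV))
    (ENNReal.Tendsto.const_mul (a := traceConst N s)
      ((ENNReal.Tendsto.mul (sq eu₂) (Or.inr fG₁) (sq eG₁) (Or.inr fu₂)).add
        (ENNReal.Tendsto.mul (sq eu₁) (Or.inr fG₂) (sq eG₂) (Or.inr fu₁))) (Or.inr hC)) hineq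
  have hreal := ENNReal.toReal_mono (ENNReal.mul_ne_top hC (ENNReal.add_ne_top.2
    ⟨ENNReal.mul_ne_top fu₂ fG₁, ENNReal.mul_ne_top fu₁ fG₂⟩)) hlim
  rw [ENNReal.toReal_mul, ENNReal.toReal_mul, ENNReal.toReal_mul, ENNReal.toReal_add
    (ENNReal.mul_ne_top fu₂ fG₁) (ENNReal.mul_ne_top fu₁ fG₂), ENNReal.toReal_mul,
    ENNReal.toReal_mul, ← i₁, ← i₂, ← j₁, ← j₂] at hreal
  have p₁ : 0 < ∫ X, u₁ X ^ 2 ∂(weightedSurf N s) := lt_of_le_of_ne (by positivity) n₁.symm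
  have p₂ : 0 < ∫ X, u₂ X ^ 2 ∂(weightedSurf N s) := lt_of_le_of_ne (by positivity) n₂.symm
  have q₁ : 0 ≤ ∫ X, ‖G₁ X‖ ^ 2 ∂(weightedSurf N s) := by positivity
  have q₂ : 0 ≤ ∫ X, ‖G₂ X‖ ^ 2 ∂(weightedSurf N s) := by positivity
  generalize (∫ X, u₁ X ^ 2 ∂(weightedSurf N s)) = a₁ at *
  generalize (∫ X, u₂ X ^ 2 ∂(weightedSurf N s)) = a₂ at *
  generalize (∫ X, ‖G₁ X‖ ^ 2 ∂(weightedSurf N s)) = g₁ at *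
  generalize (∫ X, ‖G₂ X‖ ^ 2 ∂(weightedSurf N s)) = g₂ at *
  have hC0 : 0 ≤ (traceConst N s).toReal := ENNReal.toReal_nonneg
  rw [gapConst, div_le_iff₀ (by positivity), div_add_div _ _ p₁.ne' p₂.ne', div_mul_eq_mul_div,
    le_div_iff₀ (by positivity)]
  have : 0 ≤ g₁ * a₂ + a₁ * g₂ := by positivity
  nlinarith

/-- The coordinate `y` is an admissible function for every set, so that the infimum defining the
first eigenvalue is not the junk value of an empty set. -/
theorem rayleigh_set_nonempty {s : ℝ} (hs1 : s < 1) (Ω : Set (equator N)) :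
    {R : ℝ | ∃ (u : USphere N → ℝ) (G : USphere N → Ambient N),
      MemH1 s u G ∧ VanishesOff s Ω u G ∧
      ∫ X, u X ^ 2 ∂(weightedSurf N s) ≠ 0 ∧
      R = (∫ X, ‖G X‖ ^ 2 ∂(weightedSurf N s)) /
        ∫ X, u X ^ 2 ∂(weightedSurf N s)}.Nonempty := by
  have hw : ContDiff ℝ ∞ (height : Ambient N → ℝ) :=
    (EuclideanSpace.proj (Fin.last N) : Ambient N →L[ℝ] ℝ).contDiff
  refine ⟨_, _, _, memH1_of_contDiff hs1 hw, vanishesOff_of_contDiff s hw fun X _ => X.2.2, ?_, rfl⟩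
  have := integral_weightedSurf_rpow N s 2
  simp only [Real.rpow_two] at this
  rw [this]
  exact (sphereMoment_pos N (by linarith)).ne'

theorem gapConst_le_add_firstEigenvalue (hN : 2 ≤ N) {s : ℝ} (hs0 : 0 < s) (hs1 : s < 1)
    {Ω₁ Ω₂ : Set (equator N)} (hΩ : Ω₁ ∩ Ω₂ = ∅) :
    gapConst N s ≤ firstEigenvalue s Ω₁ + firstEigenvalue s Ω₂ := by
  rw [← sub_le_iff_le_add]
  refine le_csInf (rayleigh_set_nonempty hs1 Ω₁) ?_
  rintro R₁ ⟨u₁, G₁, h₁, v₁, n₁, rfl⟩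
  rw [sub_le_comm]
  refine le_csInf (rayleigh_set_nonempty hs1 Ω₂) ?_
  rintro R₂ ⟨u₂, G₂, h₂, v₂, n₂, rfl⟩
  rw [sub_le_iff_le_add']
  exact gapConst_le_add_rayleigh hN hs0 hs1 hΩ h₁ h₂ v₁ v₂ n₁ n₂

theorem growthRate_mono (N : ℕ) (s : ℝ) : Monotone (growthRate N s) := by
  intro t t' h
  unfold growthRate
  gcongr

theorem growthRate_zero (hN : 2 ≤ N) {s : ℝ} (hs1 : s < 1) : growthRate N s 0 = 0 := by
  have hN' : (2 : ℝ) ≤ N := by exact_mod_cast hN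
  rw [growthRate, add_zero, Real.sqrt_sq (by linarith), sub_self]

theorem growthRate_firstEigenvalue_nonneg (hN : 2 ≤ N) {s : ℝ} (hs1 : s < 1)
    (Ω : Set (equator N)) : 0 ≤ growthRate N s (firstEigenvalue s Ω) := by
  rw [← growthRate_zero hN hs1]
  exact growthRate_mono N s (firstEigenvalue_nonneg s Ω)

theorem growthRate_pos (hN : 2 ≤ N) {s t : ℝ} (hs1 : s < 1) (ht : 0 < t) :
    0 < growthRate N s t := by
  rw [← growthRate_zero hN hs1, growthRate, growthRate]
  gcongr

theorem growthRate_two_mul {s : ℝ} (hs0 : 0 < s) : growthRate N s (2 * s * N) = 2 * s := by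
  have hN : (0 : ℝ) ≤ N := Nat.cast_nonneg N
  rw [growthRate, show (((N : ℝ) - 2 * s) / 2) ^ 2 + 2 * s * N = ((N + 2 * s) / 2) ^ 2 by ring,
    Real.sqrt_sq (by positivity)]
  ring

theorem nuACF_pos (hN : 2 ≤ N) {s : ℝ} (hs0 : 0 < s) (hs1 : s < 1) : 0 < nuACF N s := by
  have hgap := growthRate_pos hN hs1 (half_pos (gapConst_pos N s))
  refine (half_pos hgap).trans_le (le_csInf ⟨_, ∅, ∅, isOpen_empty, isOpen_empty, by simp, rfl⟩ ?_)
  rintro r ⟨Ω₁, Ω₂, -, -, hΩ, rfl⟩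
  have hsum := gapConst_le_add_firstEigenvalue hN hs0 hs1 hΩ
  have n₁ := growthRate_firstEigenvalue_nonneg hN hs1 Ω₁
  have n₂ := growthRate_firstEigenvalue_nonneg hN hs1 Ω₂
  rcases le_total (gapConst N s / 2) (firstEigenvalue s Ω₁) with h | h
  · have := growthRate_mono N s h
    linarith
  · have := growthRate_mono N s
      (show gapConst N s / 2 ≤ firstEigenvalue s Ω₂ by linarith)
    linarith

theorem nuACF_le (hN : 2 ≤ N) {s : ℝ} (hs0 : 0 < s) (hs1 : s < 1) : nuACF N s ≤ s := by
  have hle : nuACF N s ≤ (growthRate N s (firstEigenvalue s (univ : Set (equator N))) +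
      growthRate N s (firstEigenvalue s (∅ : Set (equator N)))) / 2 := by
    refine csInf_le ⟨0, ?_⟩ ⟨univ, ∅, isOpen_univ, isOpen_empty, by simp, rfl⟩
    rintro r ⟨Ω₁, Ω₂, -, -, -, rfl⟩
    have := growthRate_firstEigenvalue_nonneg hN hs1 Ω₁
    have := growthRate_firstEigenvalue_nonneg hN hs1 Ω₂
    positivity
  have hempty := growthRate_mono N s (firstEigenvalue_empty_le (N := N) hs0 hs1)
  rw [growthRate_two_mul hs0] at hempty
  rw [firstEigenvalue_univ hs1, growthRate_zero hN hs1] at hle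
  linarith

end SegregationACF

end

theorem mainTheorem6 (N : ℕ) (hN : 2 ≤ N) (s : ℝ) (hs0 : 0 < s) (hs1 : s < 1) :
    0 < SegregationACF.nuACF N s ∧ SegregationACF.nuACF N s ≤ s :=
  ⟨SegregationACF.nuACF_pos hN hs0 hs1, SegregationACF.nuACF_le hN hs0 hs1⟩
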